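/- Let $\mathcal C=(\mathcal C,\mathbb E,\mathfrak s)$ be an extriangulated category (in the sense of Nakaoka--Palu) and let $\xi$ be a proper class of $\mathbb E$-triangles, i.e. a class of $\mathbb E$-triangles that is closed under isomorphisms, finite coproducts, base change and cobase change, contains all split $\mathbb E$-triangles, and is saturated: for $\mathbb E$-triangles $A_1\to B_1\xrightarrow{y_1} C\overset{\delta_1}{\dashrightarrow}$ and $A_2\xrightarrow{x_2} B_2\xrightarrow{y_2} C\overset{\delta_2}{\dashrightarrow}$ and a commutative diagram completing them by realizations $A_1\to N\to B_2$ of $y_2^*\delta_1$ and $A_2\to N\to B_1$ of $y_1^*\delta_2$, if $A_2\to B_2\to C\dashrightarrow$ and $A_1\to N\to B_2\dashrightarrow$ belong to $\xi$, then so does $A_1\to B_1\to C\dashrightarrow$. An object $P$ is $\xi$-projective if $0\to\mathcal C(P,A)\to\mathcal C(P,B)\to\mathcal C(P,C)\to 0$ is exact for every $\mathbb E$-triangle $A\to B\to C\dashrightarrow$ in $\xi$; $\xi$-injective objects are defined dually. Write $\mathcal P(\xi)$ and $\mathcal I(\xi)$ for the classes of $\xi$-projective and $\xi$-injective objects. An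 object is $\xi$-Gorenstein projective if it is isomorphic to one of the objects $K_n$ of some complex $\cdots\to P_1\xrightarrow{d_1} P_0\xrightarrow{d_0} P_{-1}\to\cdots$ of $\xi$-projective objects, equipped, for every $n\in\mathbb Z$, with an $\mathbb E$-triangle $K_{n+1}\xrightarrow{g_n} P_n\xrightarrow{f_n} K_n\dashrightarrow$ in $\xi$ such that $d_n=g_{n-1}f_n$ and such that $0\to\mathcal C(K_n,W)\to\mathcal C(P_n,W)\to\mathcal C(K_{n+1},W)\to 0$ is exact for all $W\in\mathcal P(\xi)$. Dually, $\xi$-Gorenstein injective objects are defined by complexes of $\xi$-injective objects with $\mathbb E$-triangles in $\xi$ that stay exact under $\mathcal C(W,-)$ for all $W\in\mathcal I(\xi)$. For $\mathcal X=\mathcal P(\xi)$ (respectively $\mathcal X$ the class of $\xi$-Gorenstein projective objects), define inductively: an object $A$ has dimension $\leqslant 0$ if $A\in\mathcal X$, and for $n\geqslant 1$ it has dimension $\leqslant n$ if $A\in\mathcal X$ or there is an $\mathbb E$-triangle $K\to X\to A\dashrightarrow$ in $\xi$ with $X\in\mathcal X$ and $K$ of dimension $\leqslant n-1$. The $\xi$-projective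 dimension $\xi\text{-}\mathrm{pd}\,A$ (respectively the $\xi$-Gorenstein projective dimension $\xi\text{-}\mathcal G\mathrm{pd}\,A$) is the least such $n$, or $\infty$ if there is none. Dually, one defines $\xi\text{-}\mathrm{id}\,A$ and $\xi\text{-}\mathcal G\mathrm{id}\,A$ through $\mathbb E$-triangles $A\to X\to K\dashrightarrow$ in $\xi$. Let $M$ be an object of $\mathcal C$. (1) If $\xi\text{-}\mathrm{id}\,M<\infty$, then $\xi\text{-}\mathcal G\mathrm{pd}\,M=\xi\text{-}\mathrm{pd}\,M$. (2) If $\xi\text{-}\mathrm{pd}\,M<\infty$, then $\xi\text{-}\mathcal G\mathrm{id}\,M=\xi\text{-}\mathrm{id}\,M$. Both equalities are equalities in $\mathbb N\cup\{\infty\}$. -/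

import Mathlib

open CategoryTheory CategoryTheory.Limits Opposite

universe w v u

section Sequences

variable {C : Type u} [Category.{v} C]

/-- A sequence `X ⟶ Y ⟶ Z` with prescribed end terms `X` and `Z`. -/
structure EndSeq (X Z : C) where
  mid : C
  inc : X ⟶ mid
  pro : mid ⟶ Z

/-- Two sequences with the same ends are equivalent if there is an isomorphism of the middle
terms which is compatible with the identities of the end terms. -/
def EndSeq.Equivalent {X Z : C} (s t : EndSeq X Z) : Prop :=
  ∃ b : s.mid ≅ t.mid, s.inc ≫ b.hom = t.inc ∧ b.hom ≫ t.pro = s.pro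

instance EndSeq.setoid (X Z : C) : Setoid (EndSeq X Z) where
  r := EndSeq.Equivalent
  iseqv :=
    { refl := fun s => ⟨Iso.refl _, by simp, by simp⟩
      symm := by
        rintro s t ⟨b, h₁, h₂⟩
        exact ⟨b.symm, by simp [← h₁], by simp [← h₂]⟩
      trans := by
        rintro s t r ⟨b, h₁, h₂⟩ ⟨b', h₁', h₂'⟩
        exact ⟨b ≪≫ b', by simp [← h₁', ← h₁], by simp [← h₂', ← h₂]⟩ }

/-- The equivalence class `[X ⟶ Y ⟶ Z]` of a sequence. -/
def EndSeq.cls {X Y Z : C} (x : X ⟶ Y) (y : Y ⟶ Z) : Quotient (EndSeq.setoid X Z) :=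
  Quotient.mk _ ⟨Y, x, y⟩

end Sequences

section Bifunctor

variable {C : Type u} [Category.{v} C]

/-- The set `𝔼(Z, X)` of `𝔼`-extensions. -/
abbrev ExtOf (E : Cᵒᵖ ⥤ C ⥤ AddCommGrpCat.{w}) (Z X : C) : Type w :=
  (E.obj (op Z)).obj X

/-- `a_* δ`. -/
def extPush (E : Cᵒᵖ ⥤ C ⥤ AddCommGrpCat.{w}) {Z X X' : C} (a : X ⟶ X') (δ : ExtOf E Z X) :
    ExtOf E Z X' :=
  ((E.obj (op Z)).map a).hom δ

/-- `c^* δ`. -/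
def extPull (E : Cᵒᵖ ⥤ C ⥤ AddCommGrpCat.{w}) {Z Z' X : C} (c : Z' ⟶ Z) (δ : ExtOf E Z X) :
    ExtOf E Z' X :=
  ((E.map c.op).app X).hom δ

/-- The direct sum `δ ⊕ δ' ∈ 𝔼(Z ⊕ Z', X ⊕ X')` of two extensions. -/
noncomputable def extSum [Preadditive C] [HasBinaryBiproducts C]
    (E : Cᵒᵖ ⥤ C ⥤ AddCommGrpCat.{w}) {Z X Z' X' : C} (δ : ExtOf E Z X) (δ' : ExtOf E Z' X') :
    ExtOf E (Z ⊞ Z') (X ⊞ X') :=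
  extPush E biprod.inl (extPull E biprod.fst δ) + extPush E biprod.inr (extPull E biprod.snd δ')

end Bifunctor

/-- The structure `(𝔼, 𝔰)` of an extriangulated category, in the sense of Nakaoka and Palu, on an
additive category. -/
structure ExtriangulatedStructure (C : Type u) [Category.{v} C] [Preadditive C]
    [HasBinaryBiproducts C] where
  /-- the additive bifunctor `𝔼 : Cᵒᵖ × C ⥤ Ab` -/
  E : Cᵒᵖ ⥤ C ⥤ AddCommGrpCat.{w}
  additive_left : E.Additive
  additive_right : ∀ Z : Cᵒᵖ, (E.obj Z).Additive
  /-- the correspondence `𝔰` -/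
  s : ∀ {Z X : C}, ExtOf E Z X → Quotient (EndSeq.setoid X Z)
  /-- `𝔰` is a realization: morphisms of extensions are realized by morphisms of sequences. -/
  realization : ∀ {X Y Z X' Y' Z' : C} (x : X ⟶ Y) (y : Y ⟶ Z) (x' : X' ⟶ Y') (y' : Y' ⟶ Z')
    (δ : ExtOf E Z X) (δ' : ExtOf E Z' X'),
    s δ = EndSeq.cls x y → s δ' = EndSeq.cls x' y' →
    ∀ (a : X ⟶ X') (c : Z ⟶ Z'), extPush E a δ = extPull E c δ' →
      ∃ b : Y ⟶ Y', x ≫ b = a ≫ x' ∧ y ≫ c = b ≫ y'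
  /-- `𝔰` is additive: the zero extension is realized by the split sequence. -/
  s_zero : ∀ (X Z : C),
    s (0 : ExtOf E Z X) = EndSeq.cls (biprod.inl : X ⟶ X ⊞ Z) (biprod.snd : X ⊞ Z ⟶ Z)
  /-- `𝔰` is additive: direct sums of extensions are realized by direct sums of sequences. -/
  s_sum : ∀ {X Y Z X' Y' Z' : C} (x : X ⟶ Y) (y : Y ⟶ Z) (x' : X' ⟶ Y') (y' : Y' ⟶ Z')
    (δ : ExtOf E Z X) (δ' : ExtOf E Z' X'),
    s δ = EndSeq.cls x y → s δ' = EndSeq.cls x' y' →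
      s (extSum E δ δ') = EndSeq.cls (biprod.map x x') (biprod.map y y')
  /-- the axiom (ET3) -/
  et3 : ∀ {X Y Z X' Y' Z' : C} (x : X ⟶ Y) (y : Y ⟶ Z) (x' : X' ⟶ Y') (y' : Y' ⟶ Z')
    (δ : ExtOf E Z X) (δ' : ExtOf E Z' X'),
    s δ = EndSeq.cls x y → s δ' = EndSeq.cls x' y' →
    ∀ (a : X ⟶ X') (b : Y ⟶ Y'), x ≫ b = a ≫ x' →
      ∃ c : Z ⟶ Z', y ≫ c = b ≫ y' ∧ extPush E a δ = extPull E c δ'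
  /-- the axiom (ET3)ᵒᵖ -/
  et3op : ∀ {X Y Z X' Y' Z' : C} (x : X ⟶ Y) (y : Y ⟶ Z) (x' : X' ⟶ Y') (y' : Y' ⟶ Z')
    (δ : ExtOf E Z X) (δ' : ExtOf E Z' X'),
    s δ = EndSeq.cls x y → s δ' = EndSeq.cls x' y' →
    ∀ (b : Y ⟶ Y') (c : Z ⟶ Z'), y ≫ c = b ≫ y' →
      ∃ a : X ⟶ X', x ≫ b = a ≫ x' ∧ extPush E a δ = extPull E c δ'
  /-- the axiom (ET4) -/
  et4 : ∀ {A₀ B₀ C₀ D₀ F₀ : C} (f : A₀ ⟶ B₀) (f' : B₀ ⟶ D₀) (g : B₀ ⟶ C₀) (g' : C₀ ⟶ F₀)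
    (δ : ExtOf E D₀ A₀) (δ' : ExtOf E F₀ B₀),
    s δ = EndSeq.cls f f' → s δ' = EndSeq.cls g g' →
    ∃ (E₀ : C) (h' : C₀ ⟶ E₀) (d : D₀ ⟶ E₀) (e : E₀ ⟶ F₀) (δ'' : ExtOf E E₀ A₀),
      g ≫ h' = f' ≫ d ∧ h' ≫ e = g' ∧
      s δ'' = EndSeq.cls (f ≫ g) h' ∧
      s (extPush E f' δ') = EndSeq.cls d e ∧
      extPull E d δ'' = δ ∧
      extPush E f δ'' = extPull E e δ'
  /-- the axiom (ET4)ᵒᵖ -/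
  et4op : ∀ {A₀ B₀ C₀ D₀ F₀ : C} (f' : D₀ ⟶ A₀) (f : A₀ ⟶ B₀) (g' : F₀ ⟶ B₀) (g : B₀ ⟶ C₀)
    (δ : ExtOf E B₀ D₀) (δ' : ExtOf E C₀ F₀),
    s δ = EndSeq.cls f' f → s δ' = EndSeq.cls g' g →
    ∃ (E₀ : C) (h' : E₀ ⟶ A₀) (d : D₀ ⟶ E₀) (e : E₀ ⟶ F₀) (δ'' : ExtOf E C₀ E₀),
      h' ≫ f = e ≫ g' ∧ d ≫ h' = f' ∧
      s δ'' = EndSeq.cls h' (f ≫ g) ∧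
      s (extPull E g' δ) = EndSeq.cls d e ∧
      extPush E e δ'' = δ' ∧
      extPull E g δ'' = extPush E d δ

namespace ExtriangulatedStructure

variable {C : Type u} [Category.{v} C] [Preadditive C] [HasBinaryBiproducts C]

/-- An `𝔼`-triangle `X ⟶ Y ⟶ Z ⇢`. -/
structure ETriangle (S : ExtriangulatedStructure.{w} C) where
  {X : C}
  {Y : C}
  {Z : C}
  x : X ⟶ Y
  y : Y ⟶ Z
  δ : ExtOf S.E Z X
  realizes : S.s δ = EndSeq.cls x y

/-- Two `𝔼`-triangles are isomorphic if there is a morphism `(a, b, c)` of `𝔼`-triangles between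
them all of whose components are isomorphisms. -/
def ETriangle.Isomorphic {S : ExtriangulatedStructure.{w} C} (T T' : S.ETriangle) : Prop :=
  ∃ (a : T.X ≅ T'.X) (b : T.Y ≅ T'.Y) (c : T.Z ≅ T'.Z),
    T.x ≫ b.hom = a.hom ≫ T'.x ∧ T.y ≫ c.hom = b.hom ≫ T'.y ∧
      extPush S.E a.hom T.δ = extPull S.E c.hom T'.δ

/-- The coproduct (direct sum) of two `𝔼`-triangles. -/
noncomputable def ETriangle.sum {S : ExtriangulatedStructure.{w} C} (T T' : S.ETriangle) :
    S.ETriangle where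
  x := biprod.map T.x T'.x
  y := biprod.map T.y T'.y
  δ := extSum S.E T.δ T'.δ
  realizes := S.s_sum _ _ _ _ _ _ T.realizes T'.realizes

/-- `ξ` is saturated: given `𝔼`-triangles `A₁ ⟶ B₁ ⟶ Z` (with extension `δ₁`) and `A₂ ⟶ B₂ ⟶ Z`
(with extension `δ₂`) and a commutative diagram
```
         A₂ === A₂
         |      |
   A₁ -> N  ->  B₂
   ||    |      |
   A₁ -> B₁ ->  Z
```
in which the second row realizes `y₂^* δ₁` and the second column realizes `y₁^* δ₂`: if the third
column and the second row belong to `ξ`, then so does the third row. -/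
def IsSaturated {S : ExtriangulatedStructure.{w} C} (ξ : Set S.ETriangle) : Prop :=
  ∀ {A₁ B₁ A₂ B₂ Z N : C} (x₁ : A₁ ⟶ B₁) (y₁ : B₁ ⟶ Z) (δ₁ : ExtOf S.E Z A₁)
    (x₂ : A₂ ⟶ B₂) (y₂ : B₂ ⟶ Z) (δ₂ : ExtOf S.E Z A₂)
    (h₁ : S.s δ₁ = EndSeq.cls x₁ y₁) (h₂ : S.s δ₂ = EndSeq.cls x₂ y₂)
    (m₁ : A₁ ⟶ N) (e₁ : N ⟶ B₂) (m₂ : A₂ ⟶ N) (e₂ : N ⟶ B₁)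
    (hrow : S.s (extPull S.E y₂ δ₁) = EndSeq.cls m₁ e₁)
    (_hcol : S.s (extPull S.E y₁ δ₂) = EndSeq.cls m₂ e₂),
    m₂ ≫ e₁ = x₂ → m₁ ≫ e₂ = x₁ → e₂ ≫ y₁ = e₁ ≫ y₂ →
    ETriangle.mk x₂ y₂ δ₂ h₂ ∈ ξ → ETriangle.mk m₁ e₁ (extPull S.E y₂ δ₁) hrow ∈ ξ →
      ETriangle.mk x₁ y₁ δ₁ h₁ ∈ ξ

/-- Proper classes of `𝔼`-triangles. -/
structure IsProperClass {S : ExtriangulatedStructure.{w} C} (ξ : Set S.ETriangle) : Prop where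
  iso_closed : ∀ T T' : S.ETriangle, T.Isomorphic T' → T ∈ ξ → T' ∈ ξ
  sum_mem : ∀ T T' : S.ETriangle, T ∈ ξ → T' ∈ ξ → T.sum T' ∈ ξ
  split_mem : ∀ T : S.ETriangle, T.δ = 0 → T ∈ ξ
  baseChange : ∀ T ∈ ξ, ∀ {Y' Z' : C} (c : Z' ⟶ T.Z) (x' : T.X ⟶ Y') (y' : Y' ⟶ Z')
    (h : S.s (extPull S.E c T.δ) = EndSeq.cls x' y'), ETriangle.mk x' y' _ h ∈ ξ
  cobaseChange : ∀ T ∈ ξ, ∀ {X' Y' : C} (a : T.X ⟶ X') (x' : X' ⟶ Y') (y' : Y' ⟶ T.Z)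
    (h : S.s (extPush S.E a T.δ) = EndSeq.cls x' y'), ETriangle.mk x' y' _ h ∈ ξ
  saturated : IsSaturated ξ

/-- `0 ⟶ C(W, X) ⟶ C(W, Y) ⟶ C(W, Z) ⟶ 0` is exact. -/
def ETriangle.HomFromExact {S : ExtriangulatedStructure.{w} C} (T : S.ETriangle) (W : C) : Prop :=
  Function.Injective (fun f : W ⟶ T.X => f ≫ T.x) ∧
    Function.Exact (fun f : W ⟶ T.X => f ≫ T.x) (fun f : W ⟶ T.Y => f ≫ T.y) ∧
    Function.Surjective (fun f : W ⟶ T.Y => f ≫ T.y)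

/-- `0 ⟶ C(Z, W) ⟶ C(Y, W) ⟶ C(X, W) ⟶ 0` is exact. -/
def ETriangle.HomToExact {S : ExtriangulatedStructure.{w} C} (T : S.ETriangle) (W : C) : Prop :=
  Function.Injective (fun f : T.Z ⟶ W => T.y ≫ f) ∧
    Function.Exact (fun f : T.Z ⟶ W => T.y ≫ f) (fun f : T.Y ⟶ W => T.x ≫ f) ∧
    Function.Surjective (fun f : T.Y ⟶ W => T.x ≫ f)

variable {S : ExtriangulatedStructure.{w} C} (ξ : Set S.ETriangle)

/-- The class `𝒫(ξ)` of `ξ`-projective objects. -/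
def IsProj : ObjectProperty C := fun P => ∀ T ∈ ξ, T.HomFromExact P

/-- The class `ℐ(ξ)` of `ξ`-injective objects. -/
def IsInj : ObjectProperty C := fun I => ∀ T ∈ ξ, T.HomToExact I

/-- A `ξ`-exact complex `⋯ ⟶ X₁ ⟶ X₀ ⟶ X₋₁ ⟶ ⋯`, together with a choice of `𝔼`-triangles
`Kₙ₊₁ ⟶ Xₙ ⟶ Kₙ ⇢` in `ξ` through which the differentials factor. -/
structure ExactComplex where
  cx : ChainComplex C ℤ
  K : ℤ → C
  g : ∀ n : ℤ, K (n + 1) ⟶ cx.X n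
  f : ∀ n : ℤ, cx.X n ⟶ K n
  δ : ∀ n : ℤ, ExtOf S.E (K n) (K (n + 1))
  realizes : ∀ n : ℤ, S.s (δ n) = EndSeq.cls (g n) (f n)
  mem : ∀ n : ℤ, ETriangle.mk (g n) (f n) (δ n) (realizes n) ∈ ξ
  d_eq : ∀ n : ℤ, cx.d (n + 1) n = f (n + 1) ≫ g n

variable {ξ} in
/-- The `𝔼`-triangle `Kₙ₊₁ ⟶ Xₙ ⟶ Kₙ ⇢` of a `ξ`-exact complex. -/
def ExactComplex.triangle (D : ExactComplex ξ) (n : ℤ) : S.ETriangle :=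
  ETriangle.mk (D.g n) (D.f n) (D.δ n) (D.realizes n)

variable {ξ} in
/-- Complete `ξ`-projective resolutions: the terms are `ξ`-projective and the `𝔼`-triangles are
`C(-, 𝒫(ξ))`-exact. -/
def ExactComplex.IsCompleteProjRes (D : ExactComplex ξ) : Prop :=
  (∀ n : ℤ, IsProj ξ (D.cx.X n)) ∧
    ∀ (n : ℤ) (W : C), IsProj ξ W → (D.triangle n).HomToExact W

variable {ξ} in
/-- Complete `ξ`-injective coresolutions: the terms are `ξ`-injective and the `𝔼`-triangles are
`C(ℐ(ξ), -)`-exact. -/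
def ExactComplex.IsCompleteInjCores (D : ExactComplex ξ) : Prop :=
  (∀ n : ℤ, IsInj ξ (D.cx.X n)) ∧
    ∀ (n : ℤ) (W : C), IsInj ξ W → (D.triangle n).HomFromExact W

/-- The class `𝒢𝒫(ξ)` of `ξ`-Gorenstein projective objects. -/
def IsGProj : ObjectProperty C := fun G =>
  ∃ D : ExactComplex ξ, D.IsCompleteProjRes ∧ ∃ n : ℤ, Nonempty (D.K n ≅ G)

/-- The class `𝒢ℐ(ξ)` of `ξ`-Gorenstein injective objects. -/
def IsGInj : ObjectProperty C := fun G =>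
  ∃ D : ExactComplex ξ, D.IsCompleteInjCores ∧ ∃ n : ℤ, Nonempty (D.K n ≅ G)

/-- The dimension of an object with respect to `ξ`-resolutions by objects of `𝒳` is at most `n`:
either the object lies in `𝒳`, or `n ≥ 1` and there is an `𝔼`-triangle `K ⟶ P ⟶ A ⇢` in `ξ` with
`P` in `𝒳` and with `K` of dimension at most `n - 1`. -/
def ResDimLE (𝒳 : ObjectProperty C) : ℕ → C → Prop
  | 0, A => 𝒳 A
  | n + 1, A => 𝒳 A ∨
      ∃ (K P : C) (x : K ⟶ P) (y : P ⟶ A) (δ : ExtOf S.E A K) (h : S.s δ = EndSeq.cls x y),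
        ETriangle.mk x y δ h ∈ ξ ∧ 𝒳 P ∧ ResDimLE 𝒳 n K

/-- The dual of `ResDimLE`, through `𝔼`-triangles `A ⟶ I ⟶ K ⇢` in `ξ` with `I` in `𝒳`. -/
def CoresDimLE (𝒳 : ObjectProperty C) : ℕ → C → Prop
  | 0, A => 𝒳 A
  | n + 1, A => 𝒳 A ∨
      ∃ (I K : C) (x : A ⟶ I) (y : I ⟶ K) (δ : ExtOf S.E K A) (h : S.s δ = EndSeq.cls x y),
        ETriangle.mk x y δ h ∈ ξ ∧ 𝒳 I ∧ CoresDimLE 𝒳 n K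

/-- The `ξ`-projective dimension: the least `n` such that the dimension is at most `n`, and `⊤` if
there is none. -/
noncomputable def projDim (A : C) : ℕ∞ := ⨅ (n : ℕ) (_ : ResDimLE ξ (IsProj ξ) n A), (n : ℕ∞)

/-- The `ξ`-injective dimension. -/
noncomputable def injDim (A : C) : ℕ∞ := ⨅ (n : ℕ) (_ : CoresDimLE ξ (IsInj ξ) n A), (n : ℕ∞)

/-- The `ξ`-Gorenstein projective dimension. -/
noncomputable def gProjDim (A : C) : ℕ∞ := ⨅ (n : ℕ) (_ : ResDimLE ξ (IsGProj ξ) n A), (n : ℕ∞)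

/-- The `ξ`-Gorenstein injective dimension. -/
noncomputable def gInjDim (A : C) : ℕ∞ := ⨅ (n : ℕ) (_ : CoresDimLE ξ (IsGInj ξ) n A), (n : ℕ∞)

end ExtriangulatedStructure

/-! ### Functoriality of `𝔼`-extensions. -/

section Bifunctor

variable {C : Type u} [Category.{v} C] (E : Cᵒᵖ ⥤ C ⥤ AddCommGrpCat.{w}) {X X' X'' Z Z' Z'' : C}

/-! Suppose `M` has `ξ`-Gorenstein projective dimension at most `n`. The first step is to embed `M`
in a triangle `M ⟶ Y ⟶ G` of `ξ` where `Y` has `ξ`-projective dimension at most `n` and `G` behaves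
like a Gorenstein projective object (`exists_inflation_of_resDimLE`). If `M` also has finite
`ξ`-injective dimension, dimension shifting kills every extension in `ξ` of `G` by `M`
(`ProjCoresolvable.eq_zero`). The triangle then splits, `M` is a summand of `Y`, and a Schanuel
argument passes the bound to summands (`ResDimLE.of_summand`). The other inequality holds because
`ξ`-projectives are `ξ`-Gorenstein projective.

Neither enough projectives nor enough injectives are assumed, so there are no derived functors of
`ξ`: shifting is done with first extensions only. Of a Gorenstein projective object only a finite
coresolution by projectives with orthogonal cosyzygies is retained. This weaker notion,
`ProjCoresolvable`, is closed under extensions by a horseshoe argument, and its length `k` can be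
matched to the injective dimension of `M`.

Saturation is what makes all this stay inside `ξ`: it yields closure of `ξ`-inflations and
`ξ`-deflations under composition. Part (2) is the dual argument, written out with pullbacks in place
of pushouts. -/

@[simp]
lemma extPush_id (δ : ExtOf E Z X) : extPush E (𝟙 X) δ = δ := by simp [extPush]

@[simp]
lemma extPull_id (δ : ExtOf E Z X) : extPull E (𝟙 Z) δ = δ := by simp [extPull]

lemma extPush_comp (a : X ⟶ X') (b : X' ⟶ X'') (δ : ExtOf E Z X) :
    extPush E (a ≫ b) δ = extPush E b (extPush E a δ) := by simp [extPush]

lemma extPull_comp (c : Z'' ⟶ Z') (d : Z' ⟶ Z) (δ : ExtOf E Z X) :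
    extPull E (c ≫ d) δ = extPull E c (extPull E d δ) := by simp [extPull]

lemma extPull_extPush (a : X ⟶ X') (c : Z' ⟶ Z) (δ : ExtOf E Z X) :
    extPull E c (extPush E a δ) = extPush E a (extPull E c δ) := by
  have h := (E.map c.op).naturality a
  exact congrArg (fun f => f.hom δ) h

@[simp]
lemma extPush_zero (a : X ⟶ X') : extPush E a (0 : ExtOf E Z X) = 0 := by simp [extPush]

@[simp]
lemma extPull_zero (c : Z' ⟶ Z) : extPull E c (0 : ExtOf E Z X) = 0 := by simp [extPull]

lemma extPush_add (a : X ⟶ X') (δ δ' : ExtOf E Z X) :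
    extPush E a (δ + δ') = extPush E a δ + extPush E a δ' := by simp [extPush]

lemma extPull_add (c : Z' ⟶ Z) (δ δ' : ExtOf E Z X) :
    extPull E c (δ + δ') = extPull E c δ + extPull E c δ' := by simp [extPull]

end Bifunctor

lemma EndSeq.cls_eq_iff {C : Type u} [Category.{v} C] {X Y Y' Z : C} (x : X ⟶ Y) (y : Y ⟶ Z)
    (x' : X ⟶ Y') (y' : Y' ⟶ Z) :
    EndSeq.cls x y = EndSeq.cls x' y' ↔ ∃ b : Y ≅ Y', x ≫ b.hom = x' ∧ b.hom ≫ y' = y :=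
  Quotient.eq

namespace ExtriangulatedStructure

variable {C : Type u} [Category.{v} C] [Preadditive C] [HasBinaryBiproducts C]

/-! ### Splittings, exact sequences and the five lemma. -/

section Triangles

variable (S : ExtriangulatedStructure.{w} C)

lemma extPush_zero_hom {X X' Z : C} (δ : ExtOf S.E Z X) :
    extPush S.E (0 : X ⟶ X') δ = 0 := by
  have := S.additive_right (op Z)
  simp [extPush]

lemma extPull_zero_hom {X Z Z' : C} (δ : ExtOf S.E Z X) :
    extPull S.E (0 : Z' ⟶ Z) δ = 0 := by
  have := S.additive_left
  simp [extPull]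

lemma exists_realization {X Z : C} (δ : ExtOf S.E Z X) :
    ∃ (Y : C) (x : X ⟶ Y) (y : Y ⟶ Z), S.s δ = EndSeq.cls x y := by
  obtain ⟨⟨Y, x, y⟩, h⟩ := Quotient.exists_rep (S.s δ)
  exact ⟨Y, x, y, h.symm⟩

variable {S}

/-- A sequence realizing the zero extension is split. -/
lemma exists_splitting {X Y Z : C} {x : X ⟶ Y} {y : Y ⟶ Z}
    (h : S.s (0 : ExtOf S.E Z X) = EndSeq.cls x y) :
    ∃ b : Y ≅ X ⊞ Z, x ≫ b.hom = biprod.inl ∧ b.hom ≫ biprod.snd = y := by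
  rw [S.s_zero] at h
  exact (EndSeq.cls_eq_iff _ _ _ _).1 h.symm

lemma exists_retraction {X Y Z : C} {x : X ⟶ Y} {y : Y ⟶ Z}
    (h : S.s (0 : ExtOf S.E Z X) = EndSeq.cls x y) : ∃ r : Y ⟶ X, x ≫ r = 𝟙 X := by
  obtain ⟨b, h₁, -⟩ := exists_splitting h
  exact ⟨b.hom ≫ biprod.fst, by simp [reassoc_of% h₁]⟩

lemma exists_section {X Y Z : C} {x : X ⟶ Y} {y : Y ⟶ Z}
    (h : S.s (0 : ExtOf S.E Z X) = EndSeq.cls x y) : ∃ t : Z ⟶ Y, t ≫ y = 𝟙 Z := by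
  obtain ⟨b, -, h₂⟩ := exists_splitting h
  exact ⟨biprod.inr ≫ b.inv, by simp [← h₂]⟩

lemma s_zero_swap (X Z : C) :
    S.s (0 : ExtOf S.E X Z) = EndSeq.cls (biprod.inr : Z ⟶ X ⊞ Z) (biprod.fst : X ⊞ Z ⟶ X) := by
  rw [S.s_zero, EndSeq.cls_eq_iff]
  exact ⟨biprod.braiding _ _, by ext <;> simp, by simp⟩

/-- The reversed split sequence. -/
lemma exists_reversed_splitting {X Y Z : C} {x : X ⟶ Y} {y : Y ⟶ Z}
    (h : S.s (0 : ExtOf S.E Z X) = EndSeq.cls x y) :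
    ∃ (t : Z ⟶ Y) (r : Y ⟶ X), S.s (0 : ExtOf S.E X Z) = EndSeq.cls t r := by
  obtain ⟨b, -, -⟩ := exists_splitting h
  refine ⟨biprod.inr ≫ b.inv, b.hom ≫ biprod.fst, ?_⟩
  rw [s_zero_swap, EndSeq.cls_eq_iff]
  exact ⟨b.symm, by simp, by simp⟩

section

variable {X Y Z : C} {x : X ⟶ Y} {y : Y ⟶ Z} {δ : ExtOf S.E Z X}

lemma lift_of_extPull_eq_zero (h : S.s δ = EndSeq.cls x y) {W : C} (c : W ⟶ Z)
    (hc : extPull S.E c δ = 0) : ∃ b : W ⟶ Y, b ≫ y = c := by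
  obtain ⟨b, -, hb⟩ := S.realization _ _ _ _ _ _ (S.s_zero X W) h (𝟙 X) c (by simp [hc])
  exact ⟨biprod.inr ≫ b, by simp [← hb]⟩

lemma extend_of_extPush_eq_zero (h : S.s δ = EndSeq.cls x y) {W : C} (a : X ⟶ W)
    (ha : extPush S.E a δ = 0) : ∃ b : Y ⟶ W, x ≫ b = a := by
  obtain ⟨b, hb, -⟩ := S.realization _ _ _ _ _ _ h (S.s_zero W Z) a (𝟙 Z) (by simp [ha])
  exact ⟨b ≫ biprod.fst, by simp [reassoc_of% hb]⟩

/-- Exactness of `C(W, Z) ⟶ 𝔼(W, X) ⟶ 𝔼(W, Y)`. -/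
lemma eq_extPull_of_extPush_eq_zero (h : S.s δ = EndSeq.cls x y) {W : C} (ε : ExtOf S.E W X)
    (hε : extPush S.E x ε = 0) : ∃ c : W ⟶ Z, ε = extPull S.E c δ := by
  obtain ⟨V, u, v, huv⟩ := S.exists_realization ε
  obtain ⟨b, hb⟩ := extend_of_extPush_eq_zero huv x hε
  obtain ⟨c, -, hc⟩ := S.et3 _ _ _ _ _ _ huv h (𝟙 X) b (by simp [hb])
  exact ⟨c, by simpa using hc⟩

/-- Exactness of `C(X, W) ⟶ 𝔼(Z, W) ⟶ 𝔼(Y, W)`. -/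
lemma eq_extPush_of_extPull_eq_zero (h : S.s δ = EndSeq.cls x y) {W : C} (ε : ExtOf S.E Z W)
    (hε : extPull S.E y ε = 0) : ∃ a : X ⟶ W, ε = extPush S.E a δ := by
  obtain ⟨V, u, v, huv⟩ := S.exists_realization ε
  obtain ⟨b, hb⟩ := lift_of_extPull_eq_zero huv y hε
  obtain ⟨a, -, ha⟩ := S.et3op _ _ _ _ _ _ h huv b (𝟙 Z) (by simp [hb])
  exact ⟨a, by simpa using ha.symm⟩

/-- Exactness of `𝔼(Z, W) ⟶ 𝔼(Y, W) ⟶ 𝔼(X, W)`. -/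
lemma eq_extPull_of_extPull_eq_zero (h : S.s δ = EndSeq.cls x y) {W : C} (ε : ExtOf S.E Y W)
    (hε : extPull S.E x ε = 0) : ∃ ε' : ExtOf S.E Z W, ε = extPull S.E y ε' := by
  obtain ⟨V, u, v, huv⟩ := S.exists_realization ε
  -- `E₀` is the kernel of `V ⟶ Y ⟶ Z`, and `W ⟶ E₀ ⟶ X` realizes the restriction of `ε` to `X`,
  -- which splits. A retraction `E₀ ⟶ W` carries `δ''` to the required extension of `Z`.
  obtain ⟨E₀, h', d, e, δ'', -, -, -, h₄, -, h₆⟩ := S.et4op _ _ _ _ _ _ huv h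
  rw [hε] at h₄
  obtain ⟨r, hr⟩ := exists_retraction h₄
  refine ⟨extPush S.E r δ'', ?_⟩
  rw [extPull_extPush, h₆, ← extPush_comp, hr, extPush_id]

/-- Exactness of `𝔼(W, X) ⟶ 𝔼(W, Y) ⟶ 𝔼(W, Z)`. -/
lemma eq_extPush_of_extPush_eq_zero (h : S.s δ = EndSeq.cls x y) {W : C} (ε : ExtOf S.E W Y)
    (hε : extPush S.E y ε = 0) : ∃ ε' : ExtOf S.E W X, ε = extPush S.E x ε' := by
  obtain ⟨V, u, v, huv⟩ := S.exists_realization ε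
  obtain ⟨E₀, h', d, e, δ'', -, -, -, h₄, -, h₆⟩ := S.et4 _ _ _ _ _ _ h huv
  rw [hε] at h₄
  obtain ⟨r, hr⟩ := exists_section h₄
  refine ⟨extPull S.E r δ'', ?_⟩
  rw [← extPull_extPush, h₆, ← extPull_comp, hr, extPull_id]

variable [HasZeroObject C]

lemma realization_comp_eq_zero (h : S.s δ = EndSeq.cls x y) : x ≫ y = 0 := by
  open ZeroObject in
  -- Compare with the split triangle `X ⟶ X ⊞ 0 ⟶ 0`: the composite factors through the zero object.
  obtain ⟨c, hc, -⟩ := S.et3 _ _ _ _ _ _ (S.s_zero X (0 : C)) h (𝟙 X) (biprod.fst ≫ x) (by simp)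
  simpa using (biprod.inl ≫= hc).symm

/-- The map `(x, 𝟙) : X ⊞ Y ⟶ Y` extends to a morphism of triangles from the split one, so `y^* δ`
is a pushforward of `0`. -/
lemma extPull_deflation_eq_zero (h : S.s δ = EndSeq.cls x y) : extPull S.E y δ = 0 := by
  have h0 := realization_comp_eq_zero h
  obtain ⟨a, -, ha⟩ := S.et3op _ _ _ _ _ _ (S.s_zero X Y) h (biprod.desc x (𝟙 Y)) y
    (by ext <;> simp [h0])
  simpa using ha.symm

lemma extPush_inflation_eq_zero (h : S.s δ = EndSeq.cls x y) : extPush S.E x δ = 0 := by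
  have h0 := realization_comp_eq_zero h
  obtain ⟨c, -, hc⟩ := S.et3 _ _ _ _ _ _ h (S.s_zero Y Z) x (biprod.lift (𝟙 Y) y)
    (by ext <;> simp [h0])
  simpa using hc

lemma extPull_eq_zero_of_lift (h : S.s δ = EndSeq.cls x y) {W : C} (b : W ⟶ Y) :
    extPull S.E (b ≫ y) δ = 0 := by
  rw [extPull_comp, extPull_deflation_eq_zero h, extPull_zero]

lemma extPush_eq_zero_of_extend (h : S.s δ = EndSeq.cls x y) {W : C} (b : Y ⟶ W) :
    extPush S.E (x ≫ b) δ = 0 := by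
  rw [extPush_comp, extPush_inflation_eq_zero h, extPush_zero]

/-- `C(W, Y)` is exact in the middle. -/
lemma lift_of_comp_deflation_eq_zero (h : S.s δ = EndSeq.cls x y) {W : C} (b : W ⟶ Y)
    (hb : b ≫ y = 0) : ∃ a : W ⟶ X, a ≫ x = b := by
  open ZeroObject in
  obtain ⟨a, ha, -⟩ := S.et3op _ _ _ _ _ _ (S.s_zero W (0 : C)) h (biprod.fst ≫ b) 0 (by simp [hb])
  exact ⟨a, by simpa using ha.symm⟩

/-- `C(Y, W)` is exact in the middle. -/
lemma extend_of_inflation_comp_eq_zero (h : S.s δ = EndSeq.cls x y) {W : C} (b : Y ⟶ W)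
    (hb : x ≫ b = 0) : ∃ c : Z ⟶ W, y ≫ c = b := by
  open ZeroObject in
  obtain ⟨c, hc, -⟩ := S.et3 _ _ _ _ _ _ h (S.s_zero (0 : C) W) 0 (b ≫ biprod.inr)
    (by simp [reassoc_of% hb])
  exact ⟨c, by simpa using hc⟩

/-- The five lemma for morphisms of `𝔼`-triangles. -/
lemma isIso_middle (h : S.s δ = EndSeq.cls x y) {X' Y' Z' : C} {x' : X' ⟶ Y'} {y' : Y' ⟶ Z'}
    {δ' : ExtOf S.E Z' X'} (h' : S.s δ' = EndSeq.cls x' y') (a : X ≅ X') (b : Y ⟶ Y') (c : Z ≅ Z')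
    (hδ : extPush S.E a.hom δ = extPull S.E c.hom δ') (h₁ : x ≫ b = a.hom ≫ x')
    (h₂ : y ≫ c.hom = b ≫ y') : IsIso b := by
  have e₁ : δ = extPull S.E c.hom (extPush S.E a.inv δ') := by
    rw [extPull_extPush, ← hδ, ← extPush_comp, a.hom_inv_id, extPush_id]
  have e₂ : δ' = extPush S.E a.hom (extPull S.E c.inv δ) := by
    rw [← extPull_extPush, hδ, ← extPull_comp, c.inv_hom_id, extPull_id]
  obtain ⟨t, ht⟩ : ∃ t : Y' ⟶ Y, t ≫ y = y' ≫ c.inv := by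
    refine lift_of_extPull_eq_zero h _ ?_
    rw [e₁, ← extPull_comp, Category.assoc, c.inv_hom_id, Category.comp_id, extPull_extPush,
      extPull_deflation_eq_zero h', extPush_zero]
  -- `t` is a section of `b` only up to an error that `y'` kills; factoring the error through `x'`
  -- gives the correction term. The retraction is corrected dually.
  obtain ⟨q, hq⟩ := lift_of_comp_deflation_eq_zero h' (𝟙 Y' - t ≫ b)
    (by simp [← h₂, reassoc_of% ht])
  obtain ⟨t', ht'⟩ : ∃ t' : Y' ⟶ Y, x' ≫ t' = a.inv ≫ x := by
    refine extend_of_extPush_eq_zero h' _ ?_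
    rw [e₂, ← extPush_comp, a.hom_inv_id_assoc, ← extPull_extPush,
      extPush_inflation_eq_zero h, extPull_zero]
  obtain ⟨q', hq'⟩ := extend_of_inflation_comp_eq_zero h (𝟙 Y - b ≫ t')
    (by simp [reassoc_of% h₁, ht'])
  have hs : (t + q ≫ a.inv ≫ x) ≫ b = 𝟙 Y' := by simp [h₁, hq]
  have hr : b ≫ (t' + y' ≫ c.inv ≫ q') = 𝟙 Y := by simp [← reassoc_of% h₂, hq']
  have : IsSplitEpi b := ⟨⟨⟨_, hs⟩⟩⟩
  have : IsSplitMono b := ⟨⟨⟨_, hr⟩⟩⟩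
  exact isIso_of_mono_of_isSplitEpi b

/-- Any realization of the transported extension receives a comparison map from `Y`, which the five
lemma makes an isomorphism. -/
lemma realizes_of_iso (h : S.s δ = EndSeq.cls x y) {X' Z' : C} (a : X ≅ X') (c : Z ≅ Z') :
    S.s (extPush S.E a.hom (extPull S.E c.inv δ)) = EndSeq.cls (a.inv ≫ x) (y ≫ c.hom) := by
  obtain ⟨Y', x', y', h'⟩ := S.exists_realization (extPush S.E a.hom (extPull S.E c.inv δ))
  have hδ : extPush S.E a.hom δ =
      extPull S.E c.hom (extPush S.E a.hom (extPull S.E c.inv δ)) := by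
    rw [extPull_extPush, ← extPull_comp, c.hom_inv_id, extPull_id]
  obtain ⟨b, h₁, h₂⟩ := S.realization _ _ _ _ _ _ h h' a.hom c.hom hδ
  have := isIso_middle h h' a b c hδ h₁ h₂
  rw [h', eq_comm, EndSeq.cls_eq_iff]
  exact ⟨asIso b, by simp [h₁], by simp [h₂]⟩

end

/-! ### Pullback and pushout squares of triangles. -/

section

variable [HasZeroObject C]

/-- The pullback of two deflations with a common target. -/
lemma exists_pullback_square {A₁ B₁ A₂ B₂ Z : C} {x₁ : A₁ ⟶ B₁} {y₁ : B₁ ⟶ Z}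
    {δ₁ : ExtOf S.E Z A₁} {x₂ : A₂ ⟶ B₂} {y₂ : B₂ ⟶ Z} {δ₂ : ExtOf S.E Z A₂}
    (h₁ : S.s δ₁ = EndSeq.cls x₁ y₁) (h₂ : S.s δ₂ = EndSeq.cls x₂ y₂) :
    ∃ (N : C) (m₁ : A₁ ⟶ N) (e₁ : N ⟶ B₂) (m₂ : A₂ ⟶ N) (e₂ : N ⟶ B₁),
      S.s (extPull S.E y₂ δ₁) = EndSeq.cls m₁ e₁ ∧ S.s (extPull S.E y₁ δ₂) = EndSeq.cls m₂ e₂ ∧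
      m₂ ≫ e₁ = x₂ ∧ m₁ ≫ e₂ = x₁ ∧ e₂ ≫ y₁ = e₁ ≫ y₂ := by
  set δ : ExtOf S.E Z (A₁ ⊞ A₂) :=
    extPush S.E biprod.inl δ₁ + extPush S.E biprod.inr δ₂ with hδ
  have hfst : extPush S.E biprod.fst δ = δ₁ := by
    rw [hδ, extPush_add, ← extPush_comp, ← extPush_comp, biprod.inl_fst, biprod.inr_fst,
      extPush_id, extPush_zero_hom, add_zero]
  have hsnd : extPush S.E biprod.snd δ = δ₂ := by
    rw [hδ, extPush_add, ← extPush_comp, ← extPush_comp, biprod.inl_snd, biprod.inr_snd,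
      extPush_id, extPush_zero_hom, zero_add]
  -- `N` is the middle term of the joint extension of `Z` by `A₁ ⊞ A₂`. By (ET4), the quotients of
  -- `N` by `A₁` and by `A₂` realize `δ₂` and `δ₁`, hence are `B₂` and `B₁`.
  obtain ⟨N, j, k, hjk⟩ := S.exists_realization δ
  obtain ⟨E₁, p₁, d₁, q₁, ε₁, a₁, b₁, c₁, f₁, -, g₁⟩ := S.et4 _ _ _ _ _ _ (S.s_zero A₁ A₂) hjk
  obtain ⟨E₂, p₂, d₂, q₂, ε₂, a₂, b₂, c₂, f₂, -, g₂⟩ :=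
    S.et4 _ _ _ _ _ _ (s_zero_swap A₁ A₂) hjk
  have hε₁ : ε₁ = extPull S.E q₁ δ₁ := by
    rw [← hfst, extPull_extPush, ← g₁, ← extPush_comp, biprod.inl_fst, extPush_id]
  have hε₂ : ε₂ = extPull S.E q₂ δ₂ := by
    rw [← hsnd, extPull_extPush, ← g₂, ← extPush_comp, biprod.inr_snd, extPush_id]
  rw [hsnd, h₂] at f₁
  rw [hfst, h₁] at f₂
  obtain ⟨i₁, hi₁, hi₁'⟩ := (EndSeq.cls_eq_iff _ _ _ _).1 f₁
  obtain ⟨i₂, hi₂, hi₂'⟩ := (EndSeq.cls_eq_iff _ _ _ _).1 f₂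
  refine ⟨N, biprod.inl ≫ j, p₁ ≫ i₁.inv, biprod.inr ≫ j, p₂ ≫ i₂.inv, ?_, ?_, ?_, ?_, ?_⟩
  · have := realizes_of_iso c₁ (Iso.refl _) i₁.symm
    simpa [hε₁, ← extPull_comp, hi₁'] using this
  · have := realizes_of_iso c₂ (Iso.refl _) i₂.symm
    simpa [hε₂, ← extPull_comp, hi₂'] using this
  · simp [reassoc_of% a₁, ← hi₁]
  · simp [reassoc_of% a₂, ← hi₂]
  · simp [← hi₁', ← hi₂', b₁, b₂]

/-- The pushout of two inflations with a common source. -/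
lemma exists_pushout_square {A B₁ B₂ Z₁ Z₂ : C} {x₁ : A ⟶ B₁} {y₁ : B₁ ⟶ Z₁}
    {δ₁ : ExtOf S.E Z₁ A} {x₂ : A ⟶ B₂} {y₂ : B₂ ⟶ Z₂} {δ₂ : ExtOf S.E Z₂ A}
    (h₁ : S.s δ₁ = EndSeq.cls x₁ y₁) (h₂ : S.s δ₂ = EndSeq.cls x₂ y₂) :
    ∃ (N : C) (m₁ : B₂ ⟶ N) (e₁ : N ⟶ Z₁) (m₂ : B₁ ⟶ N) (e₂ : N ⟶ Z₂),
      S.s (extPush S.E x₂ δ₁) = EndSeq.cls m₁ e₁ ∧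
        S.s (extPush S.E x₁ δ₂) = EndSeq.cls m₂ e₂ := by
  set δ : ExtOf S.E (Z₁ ⊞ Z₂) A :=
    extPull S.E biprod.fst δ₁ + extPull S.E biprod.snd δ₂ with hδ
  have hinl : extPull S.E biprod.inl δ = δ₁ := by
    rw [hδ, extPull_add, ← extPull_comp, ← extPull_comp, biprod.inl_fst, biprod.inl_snd,
      extPull_id, extPull_zero_hom, add_zero]
  have hinr : extPull S.E biprod.inr δ = δ₂ := by
    rw [hδ, extPull_add, ← extPull_comp, ← extPull_comp, biprod.inr_fst, biprod.inr_snd,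
      extPull_id, extPull_zero_hom, zero_add]
  obtain ⟨N, j, k, hjk⟩ := S.exists_realization δ
  obtain ⟨E₁, p₁, d₁, q₁, ε₁, -, -, c₁, f₁, -, g₁⟩ :=
    S.et4op _ _ _ _ _ _ hjk (s_zero_swap Z₁ Z₂)
  obtain ⟨E₂, p₂, d₂, q₂, ε₂, -, -, c₂, f₂, -, g₂⟩ := S.et4op _ _ _ _ _ _ hjk (S.s_zero Z₁ Z₂)
  have hε₁ : ε₁ = extPush S.E d₁ δ₁ := by
    rw [← hinl, ← extPull_extPush, ← g₁, ← extPull_comp, biprod.inl_fst, extPull_id]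
  have hε₂ : ε₂ = extPush S.E d₂ δ₂ := by
    rw [← hinr, ← extPull_extPush, ← g₂, ← extPull_comp, biprod.inr_snd, extPull_id]
  rw [hinr, h₂] at f₁
  rw [hinl, h₁] at f₂
  obtain ⟨i₁, hi₁, -⟩ := (EndSeq.cls_eq_iff _ _ _ _).1 f₁.symm
  obtain ⟨i₂, hi₂, -⟩ := (EndSeq.cls_eq_iff _ _ _ _).1 f₂.symm
  refine ⟨N, i₁.inv ≫ p₁, k ≫ biprod.fst, i₂.inv ≫ p₂, k ≫ biprod.snd, ?_, ?_⟩
  · have := realizes_of_iso c₁ i₁ (Iso.refl _)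
    simpa [hε₁, ← extPush_comp, hi₁] using this
  · have := realizes_of_iso c₂ i₂ (Iso.refl _)
    simpa [hε₂, ← extPush_comp, hi₂] using this

end

end Triangles

/-! ### Proper classes in terms of extensions. -/

section ProperClass

variable {S : ExtriangulatedStructure.{w} C}

/-- An extension belongs to `ξ` if some (equivalently, every) realization of it does. -/
def InClass (ξ : Set S.ETriangle) {Z X : C} (δ : ExtOf S.E Z X) : Prop :=
  ∃ (Y : C) (x : X ⟶ Y) (y : Y ⟶ Z) (h : S.s δ = EndSeq.cls x y), ETriangle.mk x y δ h ∈ ξ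

variable {ξ : Set S.ETriangle}

lemma inClass_of_mem {X Y Z : C} {x : X ⟶ Y} {y : Y ⟶ Z} {δ : ExtOf S.E Z X}
    {h : S.s δ = EndSeq.cls x y} (hm : ETriangle.mk x y δ h ∈ ξ) : InClass ξ δ :=
  ⟨Y, x, y, h, hm⟩

lemma InClass.mem (hξ : IsProperClass ξ) {X Y Z : C} {δ : ExtOf S.E Z X} (hδ : InClass ξ δ)
    {x : X ⟶ Y} {y : Y ⟶ Z} (h : S.s δ = EndSeq.cls x y) : ETriangle.mk x y δ h ∈ ξ := by
  obtain ⟨Y', x', y', h', hm⟩ := hδ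
  obtain ⟨b, hb, hb'⟩ := (EndSeq.cls_eq_iff _ _ _ _).1 (h'.symm.trans h)
  refine hξ.iso_closed (ETriangle.mk x' y' δ h') _ ⟨Iso.refl _, b, Iso.refl _, ?_, ?_, ?_⟩ hm
  · simp [hb]
  · simp [hb']
  · simp

lemma inClass_zero (hξ : IsProperClass ξ) (X Z : C) : InClass ξ (0 : ExtOf S.E Z X) :=
  ⟨_, _, _, S.s_zero X Z, hξ.split_mem _ rfl⟩

lemma InClass.pull (hξ : IsProperClass ξ) {X Z Z' : C} {δ : ExtOf S.E Z X} (hδ : InClass ξ δ)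
    (c : Z' ⟶ Z) : InClass ξ (extPull S.E c δ) := by
  obtain ⟨Y, x, y, h, hm⟩ := hδ
  obtain ⟨Y', x', y', h'⟩ := S.exists_realization (extPull S.E c δ)
  exact ⟨Y', x', y', h', hξ.baseChange _ hm c x' y' h'⟩

lemma InClass.push (hξ : IsProperClass ξ) {X X' Z : C} {δ : ExtOf S.E Z X} (hδ : InClass ξ δ)
    (a : X ⟶ X') : InClass ξ (extPush S.E a δ) := by
  obtain ⟨Y, x, y, h, hm⟩ := hδ
  obtain ⟨Y', x', y', h'⟩ := S.exists_realization (extPush S.E a δ)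
  exact ⟨Y', x', y', h', hξ.cobaseChange _ hm a x' y' h'⟩

lemma InClass.sum (hξ : IsProperClass ξ) {X Z X' Z' : C} {δ : ExtOf S.E Z X}
    {δ' : ExtOf S.E Z' X'} (hδ : InClass ξ δ) (hδ' : InClass ξ δ') :
    InClass ξ (extSum S.E δ δ') := by
  obtain ⟨Y, x, y, h, hm⟩ := hδ
  obtain ⟨Y', x', y', h', hm'⟩ := hδ'
  exact ⟨_, _, _, _, hξ.sum_mem _ _ hm hm'⟩

section

variable [HasZeroObject C]

/-- Extensions whose base change along a `ξ`-deflation lies in `ξ` belong to `ξ`. -/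
lemma inClass_of_pull_deflation (hξ : IsProperClass ξ) {A₁ A₂ B₂ Z : C} {δ₁ : ExtOf S.E Z A₁}
    {x₂ : A₂ ⟶ B₂} {y₂ : B₂ ⟶ Z} {δ₂ : ExtOf S.E Z A₂} (h₂ : S.s δ₂ = EndSeq.cls x₂ y₂)
    (hδ₂ : InClass ξ δ₂) (h : InClass ξ (extPull S.E y₂ δ₁)) : InClass ξ δ₁ := by
  obtain ⟨B₁, x₁, y₁, h₁⟩ := S.exists_realization δ₁
  obtain ⟨N, m₁, e₁, m₂, e₂, hrow, hcol, k₁, k₂, k₃⟩ := exists_pullback_square h₁ h₂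
  exact ⟨B₁, x₁, y₁, h₁, hξ.saturated x₁ y₁ δ₁ x₂ y₂ δ₂ h₁ h₂ m₁ e₁ m₂ e₂ hrow hcol k₁ k₂ k₃
    (hδ₂.mem hξ h₂) (h.mem hξ hrow)⟩

/-- Extensions whose cobase change along a `ξ`-inflation lies in `ξ` belong to `ξ`. -/
lemma inClass_of_push_inflation (hξ : IsProperClass ξ) {A B D Z : C} {f : A ⟶ B} {f' : B ⟶ D}
    {δ : ExtOf S.E D A} (h : S.s δ = EndSeq.cls f f') (hδ : InClass ξ δ) {ε : ExtOf S.E Z A}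
    (hε : InClass ξ (extPush S.E f ε)) : InClass ξ ε := by
  -- Only one form of saturation is an axiom. Here `q^* ε` is killed by `f`, so it is a base change
  -- of `δ` and lies in `ξ`; saturation along the `ξ`-deflation `q` then applies to `ε`.
  obtain ⟨N, u, q, huq⟩ := S.exists_realization (extPush S.E f ε)
  obtain ⟨φ, hφ⟩ := eq_extPull_of_extPush_eq_zero h (extPull S.E q ε)
    (by rw [← extPull_extPush, extPull_deflation_eq_zero huq])
  exact inClass_of_pull_deflation hξ huq hε (hφ ▸ hδ.pull hξ φ)

/-- The composite of two `ξ`-deflations is a `ξ`-deflation, and its kernel is an extension of the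
kernels. -/
lemma exists_comp_deflation (hξ : IsProperClass ξ) {A B Z D F : C} {f' : D ⟶ A} {f : A ⟶ B}
    {g' : F ⟶ B} {g : B ⟶ Z} {δ : ExtOf S.E B D} {δ' : ExtOf S.E Z F}
    (h : S.s δ = EndSeq.cls f' f) (h' : S.s δ' = EndSeq.cls g' g) (hδ : InClass ξ δ)
    (hδ' : InClass ξ δ') :
    ∃ (K : C) (k : K ⟶ A) (ε : ExtOf S.E Z K) (d : D ⟶ K) (e : K ⟶ F) (η : ExtOf S.E F D),
      S.s ε = EndSeq.cls k (f ≫ g) ∧ S.s η = EndSeq.cls d e ∧ InClass ξ ε ∧ InClass ξ η := by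
  obtain ⟨K, k, d, e, ε, -, -, h₃, h₄, h₅, h₆⟩ := S.et4op _ _ _ _ _ _ h h'
  exact ⟨K, k, ε, d, e, _, h₃, h₄,
    inClass_of_pull_deflation hξ h' hδ' (h₆ ▸ hδ.push hξ d), hδ.pull hξ g'⟩

/-- The composite of two `ξ`-inflations is a `ξ`-inflation, and its cokernel is an extension of the
cokernels. -/
lemma exists_comp_inflation (hξ : IsProperClass ξ) {A B Z D F : C} {f : A ⟶ B} {f' : B ⟶ D}
    {g : B ⟶ Z} {g' : Z ⟶ F} {δ : ExtOf S.E D A} {δ' : ExtOf S.E F B}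
    (h : S.s δ = EndSeq.cls f f') (h' : S.s δ' = EndSeq.cls g g') (hδ : InClass ξ δ)
    (hδ' : InClass ξ δ') :
    ∃ (K : C) (k : Z ⟶ K) (ε : ExtOf S.E K A) (d : D ⟶ K) (e : K ⟶ F) (η : ExtOf S.E F D),
      S.s ε = EndSeq.cls (f ≫ g) k ∧ S.s η = EndSeq.cls d e ∧ InClass ξ ε ∧ InClass ξ η := by
  obtain ⟨K, k, d, e, ε, -, -, h₃, h₄, h₅, h₆⟩ := S.et4 _ _ _ _ _ _ h h'
  exact ⟨K, k, ε, d, e, _, h₃, h₄,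
    inClass_of_push_inflation hξ h hδ (h₆ ▸ hδ'.pull hξ e), hδ'.push hξ f'⟩

end

end ProperClass

variable {S : ExtriangulatedStructure.{w} C} {ξ : Set S.ETriangle}

/-! ### Exactness of Hom, splitting, and the periodic complex. -/

section

variable [HasZeroObject C]

/-- Exactness in the middle holds for every `𝔼`-triangle; the ends are the actual conditions. -/
lemma ETriangle.homFromExact_iff (T : S.ETriangle) (W : C) :
    T.HomFromExact W ↔ Function.Injective (fun f : W ⟶ T.X => f ≫ T.x) ∧
      Function.Surjective (fun f : W ⟶ T.Y => f ≫ T.y) := by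
  refine ⟨fun h => ⟨h.1, h.2.2⟩, fun h => ⟨h.1, fun b => ⟨fun hb => ?_, ?_⟩, h.2⟩⟩
  · exact lift_of_comp_deflation_eq_zero T.realizes b hb
  · rintro ⟨a, rfl⟩
    simp [realization_comp_eq_zero T.realizes]

lemma ETriangle.homToExact_iff (T : S.ETriangle) (W : C) :
    T.HomToExact W ↔ Function.Injective (fun f : T.Z ⟶ W => T.y ≫ f) ∧
      Function.Surjective (fun f : T.Y ⟶ W => T.x ≫ f) := by
  refine ⟨fun h => ⟨h.1, h.2.2⟩, fun h => ⟨h.1, fun b => ⟨fun hb => ?_, ?_⟩, h.2⟩⟩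
  · exact extend_of_inflation_comp_eq_zero T.realizes b hb
  · rintro ⟨c, rfl⟩
    simp [reassoc_of% realization_comp_eq_zero T.realizes]

lemma InClass.eq_zero_of_isProj (hξ : IsProperClass ξ) {X P : C} {δ : ExtOf S.E P X}
    (hδ : InClass ξ δ) (hP : IsProj ξ P) : δ = 0 := by
  obtain ⟨Y, x, y, h⟩ := S.exists_realization δ
  obtain ⟨b, hb⟩ := (hP _ (hδ.mem hξ h)).2.2 (𝟙 P)
  replace hb : b ≫ y = 𝟙 P := hb
  simpa [hb] using extPull_eq_zero_of_lift h b

lemma InClass.eq_zero_of_isInj (hξ : IsProperClass ξ) {I Z : C} {δ : ExtOf S.E Z I}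
    (hδ : InClass ξ δ) (hI : IsInj ξ I) : δ = 0 := by
  obtain ⟨Y, x, y, h⟩ := S.exists_realization δ
  obtain ⟨b, hb⟩ := (hI _ (hδ.mem hξ h)).2.2 (𝟙 I)
  replace hb : x ≫ b = 𝟙 I := hb
  simpa [hb] using extPush_eq_zero_of_extend h b

lemma homFromExact_split (X Z W : C) :
    (ETriangle.mk _ _ _ (S.s_zero X Z)).HomFromExact W :=
  (ETriangle.homFromExact_iff _ W).2
    ⟨fun f g hfg => by simpa using hfg =≫ biprod.fst, fun c => ⟨c ≫ biprod.inr, by simp⟩⟩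

lemma homToExact_split (X Z W : C) :
    (ETriangle.mk _ _ _ (S.s_zero X Z)).HomToExact W :=
  (ETriangle.homToExact_iff _ W).2
    ⟨fun f g hfg => by simpa using biprod.inr ≫= hfg, fun a => ⟨biprod.fst ≫ a, by simp⟩⟩

/-- The periodic `ξ`-exact complex with terms `P ⊞ P` obtained by splicing split triangles. -/
noncomputable def periodicComplex (hξ : IsProperClass ξ) (P : C) : ExactComplex ξ where
  cx := ChainComplex.of (fun _ : ℤ => P ⊞ P) (fun _ => biprod.snd ≫ biprod.inl) (by simp)
  K _ := P
  g _ := biprod.inl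
  f _ := biprod.snd
  δ _ := 0
  realizes _ := S.s_zero P P
  mem _ := hξ.split_mem _ rfl
  d_eq n := by simp [ChainComplex.of, ChainComplex.of.d]

end

/-! ### Finite injective dimension: Gorenstein projective against projective dimension. -/

section ProjectiveSide

lemma IsProj.of_retract [HasZeroObject C] {P Q : C} (hQ : IsProj ξ Q) (i : P ⟶ Q) (r : Q ⟶ P)
    (hir : i ≫ r = 𝟙 P) : IsProj ξ P := by
  intro T hT
  have h := (T.homFromExact_iff Q).1 (hQ T hT)
  refine (T.homFromExact_iff P).2 ⟨fun f g hfg => ?_, fun c => ?_⟩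
  · have : r ≫ f = r ≫ g := h.1 (by simpa using r ≫= hfg)
    simpa [reassoc_of% hir] using i ≫= this
  · obtain ⟨b, hb⟩ := h.2 (r ≫ c)
    exact ⟨i ≫ b, by simpa [reassoc_of% hir] using i ≫= hb⟩

lemma IsProj.biprod [HasZeroObject C] {P Q : C} (hP : IsProj ξ P) (hQ : IsProj ξ Q) :
    IsProj ξ (P ⊞ Q) := by
  intro T hT
  have h := (T.homFromExact_iff P).1 (hP T hT)
  have h' := (T.homFromExact_iff Q).1 (hQ T hT)
  refine (T.homFromExact_iff _).2 ⟨fun f g hfg => ?_, fun c => ?_⟩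
  · exact biprod.hom_ext' _ _ (h.1 (by simpa using biprod.inl ≫= hfg))
      (h'.1 (by simpa using biprod.inr ≫= hfg))
  · obtain ⟨b, hb⟩ := h.2 (biprod.inl ≫ c)
    obtain ⟨b', hb'⟩ := h'.2 (biprod.inr ≫ c)
    exact ⟨biprod.desc b b', biprod.hom_ext' _ _ (by simpa using hb) (by simpa using hb')⟩

lemma isProj_of_isZero [HasZeroObject C] {P : C} (hP : IsZero P) : IsProj ξ P := fun T _ =>
  (T.homFromExact_iff P).2 ⟨fun _ _ _ => hP.eq_of_src _ _, fun _ => ⟨0, hP.eq_of_src _ _⟩⟩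

variable (ξ) in
/-- All extensions in `ξ` of `G` by `ξ`-projective objects split. -/
def ProjOrthogonal (G : C) : Prop :=
  ∀ (W : C) (δ : ExtOf S.E G W), IsProj ξ W → InClass ξ δ → δ = 0

variable (ξ) in
/-- `G` admits a coresolution of length `n` by `ξ`-projective objects, all of whose cosyzygies
(including `G`) are orthogonal to the `ξ`-projective objects. -/
def ProjCoresolvable : ℕ → C → Prop
  | 0, G => ProjOrthogonal ξ G
  | n + 1, G => ProjOrthogonal ξ G ∧
      ∃ (P G' : C) (x : G ⟶ P) (y : P ⟶ G') (δ : ExtOf S.E G' G),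
        S.s δ = EndSeq.cls x y ∧ InClass ξ δ ∧ IsProj ξ P ∧ ProjCoresolvable n G'

lemma ProjOrthogonal.of_iso (hξ : IsProperClass ξ) {G G' : C} (h : ProjOrthogonal ξ G)
    (e : G ≅ G') : ProjOrthogonal ξ G' := by
  intro W δ hW hδ
  have := h W _ hW (hδ.pull hξ e.hom)
  rw [← extPull_id _ δ, ← e.inv_hom_id, extPull_comp, this, extPull_zero]

lemma resDimLE_of_mem {𝒳 : ObjectProperty C} {A : C} (h : 𝒳 A) (n : ℕ) : ResDimLE ξ 𝒳 n A := by
  cases n with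
  | zero => exact h
  | succ n => exact Or.inl h

lemma ResDimLE.of_le {𝒳 𝒴 : ObjectProperty C} (h𝒳 : 𝒳 ≤ 𝒴) {n : ℕ} {A : C}
    (h : ResDimLE ξ 𝒳 n A) : ResDimLE ξ 𝒴 n A := by
  induction n generalizing A with
  | zero => exact h𝒳 _ h
  | succ n ih =>
    obtain h | ⟨K, P, x, y, δ, h, hm, hP, hK⟩ := h
    · exact Or.inl (h𝒳 _ h)
    · exact Or.inr ⟨K, P, x, y, δ, h, hm, h𝒳 _ hP, ih hK⟩

section

variable [HasZeroObject C]

lemma isProj_middle (hξ : IsProperClass ξ) {X Y Z : C} {x : X ⟶ Y} {y : Y ⟶ Z}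
    {δ : ExtOf S.E Z X} (h : S.s δ = EndSeq.cls x y) (hδ : InClass ξ δ) (hX : IsProj ξ X)
    (hZ : IsProj ξ Z) : IsProj ξ Y := by
  obtain rfl := hδ.eq_zero_of_isProj hξ hZ
  obtain ⟨b, -, -⟩ := exists_splitting h
  exact (hX.biprod hZ).of_retract b.hom b.inv b.hom_inv_id

lemma ProjCoresolvable.of_iso (hξ : IsProperClass ξ) {n : ℕ} {G G' : C}
    (h : ProjCoresolvable ξ n G) (e : G ≅ G') : ProjCoresolvable ξ n G' := by
  cases n with
  | zero => exact ProjOrthogonal.of_iso hξ h e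
  | succ n =>
    obtain ⟨h₁, P, G'', x, y, δ, h, hδ, hP, hG⟩ := h
    exact ⟨h₁.of_iso hξ e, P, G'', _, _, _, realizes_of_iso h e (Iso.refl _),
      (hδ.pull hξ _).push hξ _, hP, hG⟩

lemma ExactComplex.IsCompleteProjRes.projCoresolvable (hξ : IsProperClass ξ) {D : ExactComplex ξ}
    (hD : D.IsCompleteProjRes) (n : ℕ) : ∀ i : ℤ, ProjCoresolvable ξ n (D.K i) := by
  have h₀ : ∀ i : ℤ, ProjOrthogonal ξ (D.K i) := by
    intro i W δ hW hδ
    -- `δ` vanishes on the projective term, so it is a pushout of the triangle along some `a : K (i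
    -- + 1) ⟶ W`; `C(-, W)`-exactness extends `a` to that term.
    obtain ⟨a, ha⟩ := eq_extPush_of_extPull_eq_zero (D.realizes i) δ
      ((hδ.pull hξ _).eq_zero_of_isProj hξ (hD.1 i))
    obtain ⟨b, hb⟩ := (hD.2 i W hW).2.2 a
    rw [ha, ← hb]
    exact extPush_eq_zero_of_extend (D.realizes i) b
  induction n with
  | zero => exact h₀
  | succ n ih =>
    intro i
    obtain ⟨j, rfl⟩ : ∃ j, i = j + 1 := ⟨i - 1, by simp⟩
    exact ⟨h₀ _, _, _, _, _, _, D.realizes j, inClass_of_mem (D.mem j), hD.1 j, ih j⟩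

lemma IsGProj.projCoresolvable (hξ : IsProperClass ξ) {G : C} (hG : IsGProj ξ G) (n : ℕ) :
    ProjCoresolvable ξ n G := by
  obtain ⟨D, hD, i, ⟨e⟩⟩ := hG
  exact (hD.projCoresolvable hξ n i).of_iso hξ e

/-- An extension of `Y` that vanishes on `X` descends to `Z`, and saturation keeps the descended
extension in `ξ`. -/
lemma ProjOrthogonal.middle (hξ : IsProperClass ξ) {X Y Z : C} {x : X ⟶ Y} {y : Y ⟶ Z}
    {δ : ExtOf S.E Z X} (h : S.s δ = EndSeq.cls x y) (hδ : InClass ξ δ)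
    (hX : ProjOrthogonal ξ X) (hZ : ProjOrthogonal ξ Z) : ProjOrthogonal ξ Y := by
  intro W ε hW hε
  obtain ⟨ε', rfl⟩ := eq_extPull_of_extPull_eq_zero h ε (hX W _ hW (hε.pull hξ x))
  rw [hZ W ε' hW (inClass_of_pull_deflation hξ h hδ hε), extPull_zero]

/-- A horseshoe argument: `Y` embeds in an extension `V` of `P` by `Q`, and the cokernel is an
extension of `Z'` by `X'`, to which induction applies. -/
lemma ProjCoresolvable.middle (hξ : IsProperClass ξ) {n : ℕ} {X Y Z : C} {x : X ⟶ Y} {y : Y ⟶ Z}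
    {δ : ExtOf S.E Z X} (h : S.s δ = EndSeq.cls x y) (hδ : InClass ξ δ)
    (hX : ProjCoresolvable ξ n X) (hZ : ProjCoresolvable ξ n Z) : ProjCoresolvable ξ n Y := by
  induction n generalizing X Y Z with
  | zero => exact ProjOrthogonal.middle hξ h hδ hX hZ
  | succ n ih =>
    obtain ⟨hX₀, P, X', i, p, α, hα, hα', hP, hX'⟩ := hX
    obtain ⟨hZ₀, Q, Z', j, q, γ, hγ, hγ', hQ, hZ'⟩ := hZ
    refine ⟨hX₀.middle hξ h hδ hZ₀, ?_⟩
    obtain ⟨N, m₁, e₁, m₂, e₂, h₁, h₂⟩ := exists_pushout_square h hα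
    -- Orthogonality of `Z` splits `P ⟶ N ⟶ Z`. Reversing the splitting makes `Z ⟶ N` an inflation,
    -- along which `Z ⟶ Q` can be pushed out.
    rw [hZ₀ _ _ hP (hδ.push hξ i)] at h₁
    obtain ⟨t, r, htr⟩ := exists_reversed_splitting h₁
    obtain ⟨V, u₁, v₁, u₂, v₂, k₁, k₂⟩ := exists_pushout_square hγ htr
    have hV : IsProj ξ V := isProj_middle hξ k₂ ((inClass_zero hξ _ _).push hξ _) hQ hP
    obtain ⟨K, k, ε, d, e, η, hε, hη, hε', hη'⟩ :=
      exists_comp_inflation hξ h₂ k₁ (hα'.push hξ _) (hγ'.push hξ _)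
    exact ⟨V, K, _, k, ε, hε, hε', hV, ih hη hη' hX' hZ'⟩

/-- Extensions of a `ξ`-Gorenstein projective object by an object of finite `ξ`-injective dimension
split. -/
lemma ProjCoresolvable.eq_zero (hξ : IsProperClass ξ) {n : ℕ} {G L : C}
    (hG : ProjCoresolvable ξ n G) (hL : CoresDimLE ξ (IsInj ξ) n L) (δ : ExtOf S.E G L)
    (hδ : InClass ξ δ) : δ = 0 := by
  induction n generalizing G L with
  | zero => exact hδ.eq_zero_of_isInj hξ hL
  | succ n ih =>
    obtain hL | ⟨I, L', x, y, ε, hε, hm, hI, hL'⟩ := hL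
    · exact hδ.eq_zero_of_isInj hξ hL
    obtain ⟨-, P, G', i, p, γ, hγ, hγ', hP, hG'⟩ := hG
    obtain ⟨c, rfl⟩ := eq_extPull_of_extPush_eq_zero hε δ ((hδ.push hξ x).eq_zero_of_isInj hξ hI)
    -- The induction hypothesis for `G'` and `L'` extends `c : G ⟶ L'` over `P`. Projectivity then
    -- lifts it to `I`, so `c^* ε` vanishes.
    obtain ⟨c', rfl⟩ := extend_of_extPush_eq_zero hγ c (ih hG' hL' _ (hγ'.push hξ c))
    obtain ⟨b, hb⟩ := (hP _ hm).2.2 c'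
    obtain rfl : b ≫ y = c' := hb
    rw [← Category.assoc]
    exact extPull_eq_zero_of_lift hε _

/-- An object of finite `ξ`-Gorenstein projective dimension embeds into an object of finite
`ξ`-projective dimension. -/
lemma exists_inflation_of_resDimLE (hξ : IsProperClass ξ) {n : ℕ} {M : C}
    (hM : ResDimLE ξ (IsGProj ξ) n M) (k : ℕ) :
    ∃ (Y G : C) (x : M ⟶ Y) (y : Y ⟶ G) (δ : ExtOf S.E G M),
      S.s δ = EndSeq.cls x y ∧ InClass ξ δ ∧ ResDimLE ξ (IsProj ξ) n Y ∧
        ProjCoresolvable ξ k G := by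
  have hbase : ∀ {n : ℕ} {k : ℕ} {M : C}, IsGProj ξ M →
      ∃ (Y G : C) (x : M ⟶ Y) (y : Y ⟶ G) (δ : ExtOf S.E G M), S.s δ = EndSeq.cls x y ∧
        InClass ξ δ ∧ ResDimLE ξ (IsProj ξ) n Y ∧ ProjCoresolvable ξ k G := by
    intro n k M hM
    obtain ⟨-, P, G, x, y, δ, h, hδ, hP, hG⟩ := hM.projCoresolvable hξ (k + 1)
    exact ⟨P, G, x, y, δ, h, hδ, resDimLE_of_mem hP n, hG⟩
  induction n generalizing M k with
  | zero => exact hbase hM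
  | succ n ih =>
    obtain hM | ⟨K, G, x, y, δ, h, hm, hG, hK⟩ := hM
    · exact hbase hM
    -- One extra cosyzygy is requested because embedding the pushout `X` in a projective `Q` uses
    -- one up. `Y` is the cokernel of `N ⟶ X ⟶ Q`.
    obtain ⟨N, L, i, p, α, hα, hα', hN, hL⟩ := ih hK (k + 1)
    obtain ⟨X, m₁, e₁, m₂, e₂, h₁, h₂⟩ := exists_pushout_square h hα
    obtain ⟨-, Q, G', j, q, γ, hγ, hγ', hQ, hG'⟩ :=
      (hG.projCoresolvable hξ (k + 1)).middle hξ h₂ (hα'.push hξ _) hL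
    obtain ⟨Y, f, ε, d, e, η, hε, hη, hε', hη'⟩ :=
      exists_comp_inflation hξ h₁ hγ ((inClass_of_mem hm).push hξ _) hγ'
    exact ⟨Y, G', d, e, η, hη, hη', Or.inr ⟨N, Q, _, f, ε, hε, hε'.mem hξ hε, hQ, hN⟩, hG'⟩

lemma ResDimLE.biprod (hξ : IsProperClass ξ) {n : ℕ} {A Q : C}
    (hA : ResDimLE ξ (IsProj ξ) n A) (hQ : IsProj ξ Q) : ResDimLE ξ (IsProj ξ) n (A ⊞ Q) := by
  open ZeroObject in
  induction n generalizing A Q with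
  | zero => exact IsProj.biprod hA hQ
  | succ n ih =>
    obtain hA | ⟨K, P, x, y, δ, h, hm, hP, hK⟩ := hA
    · exact Or.inl (hA.biprod hQ)
    -- Adding `0 ⟶ 0 ⊞ Q ⟶ Q` changes the kernel to `K ⊞ 0`, so the induction is reused with the
    -- zero object as `Q`.
    have h0 : IsProj ξ (0 : C) := isProj_of_isZero (isZero_zero C)
    exact Or.inr ⟨K ⊞ 0, _, _, _, _, S.s_sum _ _ _ _ _ _ h (S.s_zero 0 Q),
      ((inClass_of_mem hm).sum hξ (inClass_zero hξ 0 Q)).mem hξ _,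
      hP.biprod (h0.biprod hQ), ih hK h0⟩

/-- Direct summands of objects of `ξ`-projective dimension at most `n`. -/
lemma ResDimLE.of_summand (hξ : IsProperClass ξ) {n : ℕ} {Y A B : C}
    (hY : ResDimLE ξ (IsProj ξ) n Y) (e : Y ≅ A ⊞ B) : ResDimLE ξ (IsProj ξ) n A := by
  have hproj : ∀ {Y A B : C}, IsProj ξ Y → (Y ≅ A ⊞ B) → IsProj ξ A := fun hY e =>
    hY.of_retract (biprod.inl ≫ e.inv) (e.hom ≫ biprod.fst) (by simp)
  induction n generalizing Y A B with
  | zero => exact hproj hY e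
  | succ n ih =>
    obtain hY | ⟨K, P, x, y, δ, h, hm, hP, hK⟩ := hY
    · exact Or.inl (hproj hY e)
    have h' := realizes_of_iso h (Iso.refl _) e
    have hδ' := ((inClass_of_mem hm).pull hξ e.inv).push hξ (Iso.refl _).hom
    obtain ⟨K₁, k₁, ε₁, -, -, -, hε₁, -, hε₁', -⟩ :=
      exists_comp_deflation hξ h' (s_zero_swap A B) hδ' (inClass_zero hξ _ _)
    obtain ⟨K₂, k₂, ε₂, -, -, -, hε₂, -, hε₂', -⟩ :=
      exists_comp_deflation hξ h' (S.s_zero A B) hδ' (inClass_zero hξ _ _)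
    -- Schanuel: `K₁` and `K₂` are the kernels of `P ⟶ A` and `P ⟶ B`, and comparing two
    -- presentations of `A ⊞ B` gives `K ⊞ (P ⊞ P) ≅ N ≅ (K₁ ⊞ K₂) ⊞ P`.
    obtain ⟨N, m₁, e₁, m₂, e₂, l₁, l₂, -⟩ :=
      exists_pullback_square h' (S.s_sum _ _ _ _ _ _ hε₁ hε₂)
    rw [(hδ'.pull hξ _).eq_zero_of_isProj hξ (hP.biprod hP)] at l₁
    rw [((hε₁'.sum hξ hε₂').pull hξ _).eq_zero_of_isProj hξ hP] at l₂
    obtain ⟨b₁, -, -⟩ := exists_splitting l₁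
    obtain ⟨b₂, -, -⟩ := exists_splitting l₂
    exact Or.inr ⟨K₁, P, k₁, _, ε₁, hε₁, hε₁'.mem hξ hε₁, hP,
      ih (hK.biprod hξ (hP.biprod hP)) (b₁.symm ≪≫ b₂ ≪≫ biprod.associator _ _ _)⟩

lemma IsProj.isGProj (hξ : IsProperClass ξ) {P : C} (hP : IsProj ξ P) : IsGProj ξ P :=
  ⟨periodicComplex hξ P, ⟨fun _ => hP.biprod hP, fun _ W _ => homToExact_split P P W⟩, 0,
    ⟨Iso.refl P⟩⟩

theorem resDimLE_isGProj_iff (hξ : IsProperClass ξ) {k : ℕ} {M : C}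
    (hM : CoresDimLE ξ (IsInj ξ) k M) (n : ℕ) :
    ResDimLE ξ (IsGProj ξ) n M ↔ ResDimLE ξ (IsProj ξ) n M := by
  refine ⟨fun h => ?_, ResDimLE.of_le fun _ hP => hP.isGProj hξ⟩
  -- The coresolution length of `G` is chosen equal to the bound on the injective dimension of `M`,
  -- as the vanishing lemma requires.
  obtain ⟨Y, G, x, y, δ, hδ, hδ', hY, hG⟩ := exists_inflation_of_resDimLE hξ h k
  obtain rfl := hG.eq_zero hξ hM δ hδ'
  obtain ⟨b, -, -⟩ := exists_splitting hδ
  exact hY.of_summand hξ b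

theorem gProjDim_eq_projDim (hξ : IsProperClass ξ) {M : C} (hM : injDim ξ M < ⊤) :
    gProjDim ξ M = projDim ξ M := by
  obtain ⟨k, hk⟩ : ∃ k, CoresDimLE ξ (IsInj ξ) k M := by
    by_contra! h
    simp [injDim, h] at hM
  simp only [gProjDim, projDim, resDimLE_isGProj_iff hξ hk]

end

end ProjectiveSide

/-! ### The dual argument: Gorenstein injective against injective dimension. -/

section InjectiveSide

lemma IsInj.of_retract [HasZeroObject C] {P Q : C} (hQ : IsInj ξ Q) (i : P ⟶ Q) (r : Q ⟶ P)
    (hir : i ≫ r = 𝟙 P) : IsInj ξ P := by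
  intro T hT
  have h := (T.homToExact_iff Q).1 (hQ T hT)
  refine (T.homToExact_iff P).2 ⟨fun f g hfg => ?_, fun c => ?_⟩
  · have : f ≫ i = g ≫ i := h.1 (by simpa using hfg =≫ i)
    simpa [hir] using this =≫ r
  · obtain ⟨b, hb⟩ := h.2 (c ≫ i)
    exact ⟨b ≫ r, by simpa [hir] using hb =≫ r⟩

lemma IsInj.biprod [HasZeroObject C] {P Q : C} (hP : IsInj ξ P) (hQ : IsInj ξ Q) :
    IsInj ξ (P ⊞ Q) := by
  intro T hT
  have h := (T.homToExact_iff P).1 (hP T hT)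
  have h' := (T.homToExact_iff Q).1 (hQ T hT)
  refine (T.homToExact_iff _).2 ⟨fun f g hfg => ?_, fun c => ?_⟩
  · exact biprod.hom_ext _ _ (h.1 (by simpa using hfg =≫ biprod.fst))
      (h'.1 (by simpa using hfg =≫ biprod.snd))
  · obtain ⟨b, hb⟩ := h.2 (c ≫ biprod.fst)
    obtain ⟨b', hb'⟩ := h'.2 (c ≫ biprod.snd)
    exact ⟨biprod.lift b b', biprod.hom_ext _ _ (by simpa using hb) (by simpa using hb')⟩

lemma isInj_of_isZero [HasZeroObject C] {P : C} (hP : IsZero P) : IsInj ξ P := fun T _ =>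
  (T.homToExact_iff P).2 ⟨fun _ _ _ => hP.eq_of_tgt _ _, fun _ => ⟨0, hP.eq_of_tgt _ _⟩⟩

lemma isInj_middle [HasZeroObject C] (hξ : IsProperClass ξ) {X Y Z : C} {x : X ⟶ Y} {y : Y ⟶ Z}
    {δ : ExtOf S.E Z X} (h : S.s δ = EndSeq.cls x y) (hδ : InClass ξ δ) (hX : IsInj ξ X)
    (hZ : IsInj ξ Z) : IsInj ξ Y := by
  obtain rfl := hδ.eq_zero_of_isInj hξ hX
  obtain ⟨b, -, -⟩ := exists_splitting h
  exact (hX.biprod hZ).of_retract b.hom b.inv b.hom_inv_id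

variable (ξ) in
/-- All extensions in `ξ` of `ξ`-injective objects by `G` split. -/
def InjOrthogonal (G : C) : Prop :=
  ∀ (W : C) (δ : ExtOf S.E W G), IsInj ξ W → InClass ξ δ → δ = 0

variable (ξ) in
/-- `G` admits a resolution of length `n` by `ξ`-injective objects, all of whose syzygies
(including `G`) are orthogonal to the `ξ`-injective objects. -/
def InjResolvable : ℕ → C → Prop
  | 0, G => InjOrthogonal ξ G
  | n + 1, G => InjOrthogonal ξ G ∧
      ∃ (I G' : C) (x : G' ⟶ I) (y : I ⟶ G) (δ : ExtOf S.E G G'),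
        S.s δ = EndSeq.cls x y ∧ InClass ξ δ ∧ IsInj ξ I ∧ InjResolvable n G'

lemma InjOrthogonal.of_iso (hξ : IsProperClass ξ) {G G' : C} (h : InjOrthogonal ξ G)
    (e : G ≅ G') : InjOrthogonal ξ G' := by
  intro W δ hW hδ
  have := h W _ hW (hδ.push hξ e.inv)
  rw [← extPush_id _ δ, ← e.inv_hom_id, extPush_comp, this, extPush_zero]

lemma coresDimLE_of_mem {𝒳 : ObjectProperty C} {A : C} (h : 𝒳 A) (n : ℕ) :
    CoresDimLE ξ 𝒳 n A := by
  cases n with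
  | zero => exact h
  | succ n => exact Or.inl h

lemma CoresDimLE.of_le {𝒳 𝒴 : ObjectProperty C} (h𝒳 : 𝒳 ≤ 𝒴) {n : ℕ} {A : C}
    (h : CoresDimLE ξ 𝒳 n A) : CoresDimLE ξ 𝒴 n A := by
  induction n generalizing A with
  | zero => exact h𝒳 _ h
  | succ n ih =>
    obtain h | ⟨I, K, x, y, δ, h, hm, hI, hK⟩ := h
    · exact Or.inl (h𝒳 _ h)
    · exact Or.inr ⟨I, K, x, y, δ, h, hm, h𝒳 _ hI, ih hK⟩

section

variable [HasZeroObject C]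

lemma InjResolvable.of_iso (hξ : IsProperClass ξ) {n : ℕ} {G G' : C}
    (h : InjResolvable ξ n G) (e : G ≅ G') : InjResolvable ξ n G' := by
  cases n with
  | zero => exact InjOrthogonal.of_iso hξ h e
  | succ n =>
    obtain ⟨h₁, I, G'', x, y, δ, h, hδ, hI, hG⟩ := h
    exact ⟨h₁.of_iso hξ e, I, G'', _, _, _, realizes_of_iso h (Iso.refl _) e,
      (hδ.pull hξ _).push hξ _, hI, hG⟩

lemma ExactComplex.IsCompleteInjCores.injResolvable (hξ : IsProperClass ξ) {D : ExactComplex ξ}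
    (hD : D.IsCompleteInjCores) (n : ℕ) : ∀ i : ℤ, InjResolvable ξ n (D.K i) := by
  have h₀ : ∀ i : ℤ, InjOrthogonal ξ (D.K i) := by
    intro i W δ hW hδ
    obtain ⟨j, rfl⟩ : ∃ j, i = j + 1 := ⟨i - 1, by simp⟩
    obtain ⟨a, ha⟩ := eq_extPull_of_extPush_eq_zero (D.realizes j) δ
      ((hδ.push hξ _).eq_zero_of_isInj hξ (hD.1 j))
    obtain ⟨b, hb⟩ := (hD.2 j W hW).2.2 a
    rw [ha, ← hb]
    exact extPull_eq_zero_of_lift (D.realizes j) b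
  induction n with
  | zero => exact h₀
  | succ n ih =>
    exact fun i => ⟨h₀ _, _, _, _, _, _, D.realizes i, inClass_of_mem (D.mem i), hD.1 i, ih _⟩

lemma IsGInj.injResolvable (hξ : IsProperClass ξ) {G : C} (hG : IsGInj ξ G) (n : ℕ) :
    InjResolvable ξ n G := by
  obtain ⟨D, hD, i, ⟨e⟩⟩ := hG
  exact (hD.injResolvable hξ n i).of_iso hξ e

lemma InjOrthogonal.middle (hξ : IsProperClass ξ) {X Y Z : C} {x : X ⟶ Y} {y : Y ⟶ Z}
    {δ : ExtOf S.E Z X} (h : S.s δ = EndSeq.cls x y) (hδ : InClass ξ δ)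
    (hX : InjOrthogonal ξ X) (hZ : InjOrthogonal ξ Z) : InjOrthogonal ξ Y := by
  intro W ε hW hε
  obtain ⟨ε', rfl⟩ := eq_extPush_of_extPush_eq_zero h ε (hZ W _ hW (hε.push hξ y))
  rw [hX W ε' hW (inClass_of_push_inflation hξ h hδ hε), extPush_zero]

lemma InjResolvable.middle (hξ : IsProperClass ξ) {n : ℕ} {X Y Z : C} {x : X ⟶ Y} {y : Y ⟶ Z}
    {δ : ExtOf S.E Z X} (h : S.s δ = EndSeq.cls x y) (hδ : InClass ξ δ)
    (hX : InjResolvable ξ n X) (hZ : InjResolvable ξ n Z) : InjResolvable ξ n Y := by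
  induction n generalizing X Y Z with
  | zero => exact InjOrthogonal.middle hξ h hδ hX hZ
  | succ n ih =>
    obtain ⟨hX₀, I, X', i, p, α, hα, hα', hI, hX'⟩ := hX
    obtain ⟨hZ₀, J, Z', j, q, γ, hγ, hγ', hJ, hZ'⟩ := hZ
    refine ⟨hX₀.middle hξ h hδ hZ₀, ?_⟩
    -- Dual horseshoe: `V`, an extension of `I` by `J`, maps onto `Y` with kernel an extension of
    -- `Z'` by `X'`.
    obtain ⟨N, m₁, e₁, m₂, e₂, h₁, h₂, -⟩ := exists_pullback_square h hγ
    rw [hX₀ _ _ hJ (hδ.pull hξ q)] at h₁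
    obtain ⟨t, r, htr⟩ := exists_reversed_splitting h₁
    obtain ⟨V, u₁, v₁, u₂, v₂, k₁, k₂, -⟩ := exists_pullback_square hα htr
    have hV : IsInj ξ V := isInj_middle hξ k₂ ((inClass_zero hξ _ _).pull hξ _) hJ hI
    obtain ⟨K, k, ε, d, e, η, hε, hη, hε', hη'⟩ :=
      exists_comp_deflation hξ k₁ h₂ (hα'.pull hξ _) (hγ'.pull hξ _)
    exact ⟨V, K, k, _, ε, hε, hε', hV, ih hη hη' hX' hZ'⟩

/-- Extensions of an object of finite `ξ`-projective dimension by a `ξ`-Gorenstein injective object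
split. -/
lemma InjResolvable.eq_zero (hξ : IsProperClass ξ) {n : ℕ} {G L : C}
    (hG : InjResolvable ξ n G) (hL : ResDimLE ξ (IsProj ξ) n L) (δ : ExtOf S.E L G)
    (hδ : InClass ξ δ) : δ = 0 := by
  induction n generalizing G L with
  | zero => exact hδ.eq_zero_of_isProj hξ hL
  | succ n ih =>
    obtain hL | ⟨L', P, x, y, ε, hε, hm, hP, hL'⟩ := hL
    · exact hδ.eq_zero_of_isProj hξ hL
    obtain ⟨-, I, G', i, p, γ, hγ, hγ', hI, hG'⟩ := hG
    obtain ⟨c, rfl⟩ :=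
      eq_extPush_of_extPull_eq_zero hε δ ((hδ.pull hξ y).eq_zero_of_isProj hξ hP)
    obtain ⟨c', rfl⟩ := lift_of_extPull_eq_zero hγ c (ih hG' hL' _ (hγ'.pull hξ c))
    obtain ⟨b, hb⟩ := (hI _ hm).2.2 c'
    obtain rfl : x ≫ b = c' := hb
    rw [Category.assoc]
    exact extPush_eq_zero_of_extend hε _

/-- An object of finite `ξ`-Gorenstein injective dimension is a quotient of an object of finite
`ξ`-injective dimension. -/
lemma exists_deflation_of_coresDimLE (hξ : IsProperClass ξ) {n : ℕ} {M : C}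
    (hM : CoresDimLE ξ (IsGInj ξ) n M) (k : ℕ) :
    ∃ (Y G : C) (x : G ⟶ Y) (y : Y ⟶ M) (δ : ExtOf S.E M G),
      S.s δ = EndSeq.cls x y ∧ InClass ξ δ ∧ CoresDimLE ξ (IsInj ξ) n Y ∧
        InjResolvable ξ k G := by
  have hbase : ∀ {n : ℕ} {k : ℕ} {M : C}, IsGInj ξ M →
      ∃ (Y G : C) (x : G ⟶ Y) (y : Y ⟶ M) (δ : ExtOf S.E M G), S.s δ = EndSeq.cls x y ∧
        InClass ξ δ ∧ CoresDimLE ξ (IsInj ξ) n Y ∧ InjResolvable ξ k G := by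
    intro n k M hM
    obtain ⟨-, I, G, x, y, δ, h, hδ, hI, hG⟩ := hM.injResolvable hξ (k + 1)
    exact ⟨I, G, x, y, δ, h, hδ, coresDimLE_of_mem hI n, hG⟩
  induction n generalizing M k with
  | zero => exact hbase hM
  | succ n ih =>
    obtain hM | ⟨G, K, x, y, δ, h, hm, hG, hK⟩ := hM
    · exact hbase hM
    -- Covering the pullback `X` by an injective `J` uses up one syzygy; `Y` is the kernel of `J ⟶ X
    -- ⟶ N`.
    obtain ⟨N, L, i, p, α, hα, hα', hN, hL⟩ := ih hK (k + 1)
    obtain ⟨X, m₁, e₁, m₂, e₂, h₁, h₂, -⟩ := exists_pullback_square h hα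
    obtain ⟨-, J, G', j, q, γ, hγ, hγ', hJ, hG'⟩ :=
      hL.middle hξ h₂ (hα'.pull hξ _) (hG.injResolvable hξ (k + 1))
    obtain ⟨Y, f, ε, d, e, η, hε, hη, hε', hη'⟩ :=
      exists_comp_deflation hξ hγ h₁ hγ' ((inClass_of_mem hm).pull hξ _)
    exact ⟨Y, G', d, e, η, hη, hη', Or.inr ⟨J, N, f, _, ε, hε, hε'.mem hξ hε, hJ, hN⟩, hG'⟩

lemma CoresDimLE.biprod (hξ : IsProperClass ξ) {n : ℕ} {A Q : C}
    (hA : CoresDimLE ξ (IsInj ξ) n A) (hQ : IsInj ξ Q) : CoresDimLE ξ (IsInj ξ) n (A ⊞ Q) := by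
  open ZeroObject in
  induction n generalizing A Q with
  | zero => exact IsInj.biprod hA hQ
  | succ n ih =>
    obtain hA | ⟨I, K, x, y, δ, h, hm, hI, hK⟩ := hA
    · exact Or.inl (hA.biprod hQ)
    have h0 : IsInj ξ (0 : C) := isInj_of_isZero (isZero_zero C)
    exact Or.inr ⟨_, K ⊞ 0, _, _, _, S.s_sum _ _ _ _ _ _ h (S.s_zero Q 0),
      ((inClass_of_mem hm).sum hξ (inClass_zero hξ Q 0)).mem hξ _,
      hI.biprod (hQ.biprod h0), ih hK h0⟩

/-- Direct summands of objects of `ξ`-injective dimension at most `n`. -/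
lemma CoresDimLE.of_summand (hξ : IsProperClass ξ) {n : ℕ} {Y A B : C}
    (hY : CoresDimLE ξ (IsInj ξ) n Y) (e : Y ≅ A ⊞ B) : CoresDimLE ξ (IsInj ξ) n A := by
  have hinj : ∀ {Y A B : C}, IsInj ξ Y → (Y ≅ A ⊞ B) → IsInj ξ A := fun hY e =>
    hY.of_retract (biprod.inl ≫ e.inv) (e.hom ≫ biprod.fst) (by simp)
  induction n generalizing Y A B with
  | zero => exact hinj hY e
  | succ n ih =>
    obtain hY | ⟨I, K, x, y, δ, h, hm, hI, hK⟩ := hY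
    · exact Or.inl (hinj hY e)
    have h' := realizes_of_iso h e (Iso.refl _)
    have hδ' := ((inClass_of_mem hm).pull hξ (Iso.refl _).inv).push hξ e.hom
    obtain ⟨K₁, k₁, ε₁, -, -, -, hε₁, -, hε₁', -⟩ :=
      exists_comp_inflation hξ (S.s_zero A B) h' (inClass_zero hξ _ _) hδ'
    obtain ⟨K₂, k₂, ε₂, -, -, -, hε₂, -, hε₂', -⟩ :=
      exists_comp_inflation hξ (s_zero_swap A B) h' (inClass_zero hξ _ _) hδ'
    -- Dual Schanuel comparison, with `K₁` and `K₂` the cokernels of `A ⟶ I` and `B ⟶ I`. The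
    -- splittings put the injective summand first, so they are reversed.
    obtain ⟨N, m₁, e₁, m₂, e₂, l₁, l₂⟩ :=
      exists_pushout_square h' (S.s_sum _ _ _ _ _ _ hε₁ hε₂)
    rw [(hδ'.push hξ _).eq_zero_of_isInj hξ (hI.biprod hI)] at l₁
    rw [((hε₁'.sum hξ hε₂').push hξ _).eq_zero_of_isInj hξ hI] at l₂
    obtain ⟨t₁, r₁, h₁⟩ := exists_reversed_splitting l₁
    obtain ⟨t₂, r₂, h₂⟩ := exists_reversed_splitting l₂
    obtain ⟨b₁, -, -⟩ := exists_splitting h₁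
    obtain ⟨b₂, -, -⟩ := exists_splitting h₂
    exact Or.inr ⟨I, K₁, _, k₁, ε₁, hε₁, hε₁'.mem hξ hε₁, hI,
      ih (hK.biprod hξ (hI.biprod hI)) (b₁.symm ≪≫ b₂ ≪≫ biprod.associator _ _ _)⟩

lemma IsInj.isGInj (hξ : IsProperClass ξ) {I : C} (hI : IsInj ξ I) : IsGInj ξ I :=
  ⟨periodicComplex hξ I, ⟨fun _ => hI.biprod hI, fun _ W _ => homFromExact_split I I W⟩, 0,
    ⟨Iso.refl I⟩⟩

theorem coresDimLE_isGInj_iff (hξ : IsProperClass ξ) {k : ℕ} {M : C}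
    (hM : ResDimLE ξ (IsProj ξ) k M) (n : ℕ) :
    CoresDimLE ξ (IsGInj ξ) n M ↔ CoresDimLE ξ (IsInj ξ) n M := by
  refine ⟨fun h => ?_, CoresDimLE.of_le fun _ hI => hI.isGInj hξ⟩
  obtain ⟨Y, G, x, y, δ, hδ, hδ', hY, hG⟩ := exists_deflation_of_coresDimLE hξ h k
  obtain rfl := hG.eq_zero hξ hM δ hδ'
  obtain ⟨b, -, -⟩ := exists_splitting hδ
  -- The splitting reads `Y ≅ G ⊞ M`, with `M` as second summand.
  exact hY.of_summand hξ (b ≪≫ biprod.braiding _ _)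

theorem gInjDim_eq_injDim (hξ : IsProperClass ξ) {M : C} (hM : projDim ξ M < ⊤) :
    gInjDim ξ M = injDim ξ M := by
  obtain ⟨k, hk⟩ : ∃ k, ResDimLE ξ (IsProj ξ) k M := by
    by_contra! h
    simp [projDim, h] at hM
  simp only [gInjDim, injDim, coresDimLE_isGInj_iff hξ hk]

end

end InjectiveSide

end ExtriangulatedStructure

theorem mainTheorem7 {C : Type u} [Category.{v} C] [Preadditive C] [HasZeroObject C] [HasBinaryBiproducts C]
    (S : ExtriangulatedStructure.{w} C) (ξ : Set S.ETriangle)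
    (hξ : ExtriangulatedStructure.IsProperClass ξ) (M : C) :
    (ExtriangulatedStructure.injDim ξ M < ⊤ →
      ExtriangulatedStructure.gProjDim ξ M = ExtriangulatedStructure.projDim ξ M) ∧
    (ExtriangulatedStructure.projDim ξ M < ⊤ →
      ExtriangulatedStructure.gInjDim ξ M = ExtriangulatedStructure.injDim ξ M) :=
  ⟨ExtriangulatedStructure.gProjDim_eq_projDim hξ, ExtriangulatedStructure.gInjDim_eq_injDim hξ⟩
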